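/- Let $D\ge 0$ be an integer, let $m>0$, $M\ge 0$, $\mathfrak D\ge 0$ be real numbers, and let $P_{\sf slc}$, $P_{\sf cmpct}$ be probability measures on $\mathbb R^D$ (with the Euclidean norm) such that * $P_{\sf slc}$ has an everywhere positive, differentiable density $\pi$ with respect to Lebesgue measure which is $m$-strongly log-concave, i.e. $-\log\pi$ is $m$-strongly convex on $\mathbb R^D$, and whose score function $\nabla\log\pi:\mathbb R^D\to\mathbb R^D$ is $M$-Lipschitz; * $P_{\sf cmpct}$ is supported on a bounded set of diameter $2\mathfrak D$, i.e. there is a bounded set $K\subset\mathbb R^D$ with $\operatorname{diam}K=2\mathfrak D$ and $W\in K$ almost surely for $W\sim P_{\sf cmpct}$. Let $P^*=P_{\sf slc}\star P_{\sf cmpct}$ be their convolution and $$\varphi(\sigma)=\frac{\sigma^2}{1+m\sigma^2}+\frac{\mathfrak D^2M^2\sigma^4}{(1+M\sigma^2)^2},\qquad \sigma>0 .$$ Then $\varphi(\sigma)>0$ for all $\sigma>0$, and, for $(X,\xi)\sim P^*\otimes\mathcal N(0,\mathbf I_D)$, $$\operatorname{Var}\big(X\,\big|\,X+\sigma\xi=y\big)\preccurlyeq\varphi(\sigma)\,\mathbf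 I_D\qquad\text{for all }\sigma>0\text{ and all }y\in\mathbb R^D .$$ Here $\preccurlyeq$ is the Loewner order, and $\operatorname{Var}(X\,|\,X+\sigma\xi=y)$ is the covariance matrix (whose entries are finite) of the conditional law of $X$ given $X+\sigma\xi=y$, taken for every $y$ in its canonical version, the probability measure proportional to $\exp\!\big(-\|y-x\|^2/(2\sigma^2)\big)\,P^*(\mathrm dx)$. -/

import Mathlib

open MeasureTheory ProbabilityTheory
open scoped NNReal ENNReal

noncomputable section

/-! ### Conditional law of `X` given `X + σ ξ = y` and its covariance matrix -/

/-- The conditional law of `X` given `X + σ ξ = y`, for `(X, ξ) ∼ P ⊗ 𝒩(0, I)` and `σ > 0`: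
the probability measure with density proportional to `x ↦ exp (-‖y - x‖² / (2σ²))` with respect
to `P`. It is given for *every* `y` by Bayes' formula; `condDistrib_ae_eq_gaussCondLaw` below
proves that it is the regular conditional distribution of `X` given `X + σ ξ`. -/
def gaussCondLaw {D : ℕ} (P : Measure (EuclideanSpace ℝ (Fin D))) (σ : ℝ)
    (y : EuclideanSpace ℝ (Fin D)) : Measure (EuclideanSpace ℝ (Fin D)) :=
  P.tilted (fun x => -‖y - x‖ ^ 2 / (2 * σ ^ 2))

/-- The covariance matrix of a measure on `ℝ^D`. -/
def covMat {D : ℕ} (Q : Measure (EuclideanSpace ℝ (Fin D))) : Matrix (Fin D) (Fin D) ℝ :=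
  Matrix.of fun i j => cov[fun x => x i, fun x => x j; Q]

/-- `P` satisfies the conditional variance bound with a function `φ : ℝ_{>0} → ℝ_{>0}`: for all
`σ > 0` and all `y`, the conditional law of `X` given `X + σ ξ = y` has finite second moments and
`Var (X | X + σ ξ = y) ≼ φ(σ) I_D` in the Loewner order. -/
def SatisfiesCondVarBound {D : ℕ} (P : Measure (EuclideanSpace ℝ (Fin D))) (φ : ℝ → ℝ) : Prop :=
  ∀ σ : ℝ, 0 < σ → 0 < φ σ ∧ ∀ y : EuclideanSpace ℝ (Fin D),
    MemLp (fun x : EuclideanSpace ℝ (Fin D) => x) 2 (gaussCondLaw P σ y) ∧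
      (φ σ • (1 : Matrix (Fin D) (Fin D) ℝ) - covMat (gaussCondLaw P σ y)).PosSemidef

/-! ### Log-concavity and the score -/

/-- A density `π` on `ℝ^D` is `m`-strongly log-concave: `-log π`, with value `+∞` where `π = 0`,
is `m`-strongly convex. -/
def IsStronglyLogConcave {D : ℕ} (m : ℝ) (π : EuclideanSpace ℝ (Fin D) → ℝ) : Prop :=
  (∀ x, 0 ≤ π x) ∧ StrongConvexOn {x | 0 < π x} m (fun x => -Real.log (π x))

/-- The score function `∇ log π` of a density `π`. -/
def score {D : ℕ} (π : EuclideanSpace ℝ (Fin D) → ℝ) (x : EuclideanSpace ℝ (Fin D)) :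
    EuclideanSpace ℝ (Fin D) :=
  gradient (fun z => Real.log (π z)) x

/-- The score of the density `π` is defined on the whole of `ℝ^D` and is `M`-Lipschitz. -/
def HasLipschitzScore {D : ℕ} (M : ℝ≥0) (π : EuclideanSpace ℝ (Fin D) → ℝ) : Prop :=
  (∀ x, 0 < π x) ∧ Differentiable ℝ π ∧ LipschitzWith M (score π)

/-! ### `gaussCondLaw` is the conditional distribution -/

/-- The law of `σ ξ` is the normalised Gaussian density `z ↦ exp (-‖z‖² / (2σ²))`. -/
lemma map_smul_stdGaussian_eq_tilted {D : ℕ} {σ : ℝ} (hσ : 0 < σ) :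
    Integrable (fun z : EuclideanSpace ℝ (Fin D) => Real.exp (-‖z‖ ^ 2 / (2 * σ ^ 2))) ∧
      (stdGaussian (EuclideanSpace ℝ (Fin D))).map (fun z => σ • z) =
        volume.tilted (fun z => -‖z‖ ^ 2 / (2 * σ ^ 2)) := by
  have hb : 0 < (((1 / (2 * σ ^ 2) : ℝ) : ℂ)).re := by rw [Complex.ofReal_re]; positivity
  have hb' : (0 : ℝ) < 1 / (2 * σ ^ 2) := by positivity
  have hexp : ∀ z : EuclideanSpace ℝ (Fin D), ((Real.exp (-‖z‖ ^ 2 / (2 * σ ^ 2)) : ℝ) : ℂ)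
      = Complex.exp (-((1 / (2 * σ ^ 2) : ℝ) : ℂ) * ‖z‖ ^ 2) := by
    intro z; push_cast; congr 1; ring
  have hint : Integrable
      (fun z : EuclideanSpace ℝ (Fin D) => Real.exp (-‖z‖ ^ 2 / (2 * σ ^ 2))) := by
    have h := (GaussianFourier.integrable_cexp_neg_mul_sq_norm_add
      (V := EuclideanSpace ℝ (Fin D)) hb 0 0).re
    refine h.congr (Filter.Eventually.of_forall fun z => ?_)
    simp only [zero_mul, add_zero, ← hexp]
    exact Complex.ofReal_re _
  refine ⟨hint, ?_⟩
  have : IsProbabilityMeasure ((stdGaussian (EuclideanSpace ℝ (Fin D))).map (fun z => σ • z)) :=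
    Measure.isProbabilityMeasure_map (by fun_prop)
  have : IsProbabilityMeasure ((volume : Measure (EuclideanSpace ℝ (Fin D))).tilted
    (fun z => -‖z‖ ^ 2 / (2 * σ ^ 2))) := isProbabilityMeasure_tilted hint
  apply Measure.ext_of_charFun
  ext t
  rw [charFun_map_smul, charFun_stdGaussian, charFun_apply, integral_tilted]
  have hZ : ((∫ z : EuclideanSpace ℝ (Fin D), Real.exp (-‖z‖ ^ 2 / (2 * σ ^ 2)) : ℝ) : ℂ)
      = ∫ z : EuclideanSpace ℝ (Fin D), Complex.exp (-((1 / (2 * σ ^ 2) : ℝ) : ℂ) * ‖z‖ ^ 2) := by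
    rw [← integral_complex_ofReal]; simp_rw [hexp]
  have hZ0 : (∫ z : EuclideanSpace ℝ (Fin D), Real.exp (-‖z‖ ^ 2 / (2 * σ ^ 2))) ≠ 0 :=
    (integral_exp_pos hint).ne'
  set Z := ∫ z : EuclideanSpace ℝ (Fin D), Real.exp (-‖z‖ ^ 2 / (2 * σ ^ 2))
  have e : ∀ x : EuclideanSpace ℝ (Fin D),
      (Real.exp (-‖x‖ ^ 2 / (2 * σ ^ 2)) / Z) • Complex.exp ((inner ℝ x t : ℝ) * Complex.I)
      = (Z : ℂ)⁻¹ * Complex.exp (-((1 / (2 * σ ^ 2) : ℝ) : ℂ) * ‖x‖ ^ 2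
          + Complex.I * (inner ℝ t x : ℝ)) := by
    intro x
    rw [Complex.real_smul, Complex.exp_add, ← hexp, real_inner_comm, mul_comm Complex.I]
    push_cast
    ring
  simp_rw [e]
  rw [integral_const_mul, GaussianFourier.integral_cexp_neg_mul_sq_norm_add hb,
    ← GaussianFourier.integral_cexp_neg_mul_sq_norm hb, ← hZ, ← mul_assoc,
    inv_mul_cancel₀ (by exact_mod_cast hZ0), one_mul, norm_smul, Complex.I_sq]
  congr 1
  have : (σ : ℂ) ≠ 0 := by exact_mod_cast hσ.ne'
  rw [Real.norm_of_nonneg hσ.le]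
  push_cast
  field_simp
  ring

lemma integrable_exp_gaussCondLaw {D : ℕ} (P : Measure (EuclideanSpace ℝ (Fin D)))
    [IsProbabilityMeasure P] (σ : ℝ) (y : EuclideanSpace ℝ (Fin D)) :
    Integrable (fun x => Real.exp (-‖y - x‖ ^ 2 / (2 * σ ^ 2))) P := by
  refine Integrable.of_bound (C := 1)
    (Measurable.aestronglyMeasurable (by fun_prop)) (Filter.Eventually.of_forall fun x => ?_)
  rw [Real.norm_of_nonneg (Real.exp_pos _).le, Real.exp_le_one_iff, neg_div]
  have : 0 ≤ ‖y - x‖ ^ 2 / (2 * σ ^ 2) := by positivity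
  linarith

instance isProbabilityMeasure_gaussCondLaw {D : ℕ} (P : Measure (EuclideanSpace ℝ (Fin D)))
    [IsProbabilityMeasure P] (σ : ℝ) (y : EuclideanSpace ℝ (Fin D)) :
    IsProbabilityMeasure (gaussCondLaw P σ y) :=
  isProbabilityMeasure_tilted (integrable_exp_gaussCondLaw P σ y)

lemma measurable_gaussCondLaw {D : ℕ} (P : Measure (EuclideanSpace ℝ (Fin D)))
    [IsProbabilityMeasure P] (σ : ℝ) : Measurable (gaussCondLaw P σ) := by
  refine Measure.measurable_of_measurable_coe _ fun s hs => ?_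
  simp only [gaussCondLaw, tilted_apply' _ _ hs]
  have h1 : Measurable fun p : EuclideanSpace ℝ (Fin D) × EuclideanSpace ℝ (Fin D) =>
      Real.exp (-‖p.1 - p.2‖ ^ 2 / (2 * σ ^ 2)) := by fun_prop
  have h2 : Measurable fun y : EuclideanSpace ℝ (Fin D) =>
      ∫ x, Real.exp (-‖y - x‖ ^ 2 / (2 * σ ^ 2)) ∂P :=
    (h1.stronglyMeasurable.integral_prod_right' (ν := P)).measurable
  exact Measurable.lintegral_prod_right' (ν := P.restrict s)
    (f := fun p : EuclideanSpace ℝ (Fin D) × EuclideanSpace ℝ (Fin D) =>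
      ENNReal.ofReal (Real.exp (-‖p.1 - p.2‖ ^ 2 / (2 * σ ^ 2)) /
        ∫ x, Real.exp (-‖p.1 - x‖ ^ 2 / (2 * σ ^ 2)) ∂P))
    (h1.div (h2.comp measurable_fst)).ennreal_ofReal

/-- The conditional laws `gaussCondLaw P σ y`, as a Markov kernel in `y`. -/
def gaussCondKernel {D : ℕ} (P : Measure (EuclideanSpace ℝ (Fin D))) [IsProbabilityMeasure P]
    (σ : ℝ) : Kernel (EuclideanSpace ℝ (Fin D)) (EuclideanSpace ℝ (Fin D)) where
  toFun := gaussCondLaw P σ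
  measurable' := measurable_gaussCondLaw P σ

instance isMarkovKernel_gaussCondKernel {D : ℕ} (P : Measure (EuclideanSpace ℝ (Fin D)))
    [IsProbabilityMeasure P] (σ : ℝ) : IsMarkovKernel (gaussCondKernel P σ) :=
  ⟨fun y => isProbabilityMeasure_gaussCondLaw P σ y⟩

/-- If `X ∼ P` and `ξ ∼ 𝒩(0, I)` are independent, the regular conditional distribution of `X`
given `X + σ ξ` is `y ↦ gaussCondLaw P σ y`. -/
theorem condDistrib_ae_eq_gaussCondLaw {D : ℕ} {Ω : Type*} [MeasurableSpace Ω] {μ : Measure Ω}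
    [IsProbabilityMeasure μ] {X ξ : Ω → EuclideanSpace ℝ (Fin D)}
    {P : Measure (EuclideanSpace ℝ (Fin D))} [IsProbabilityMeasure P]
    (hX : HasLaw X P μ) (hξ : HasLaw ξ (stdGaussian (EuclideanSpace ℝ (Fin D))) μ)
    (hind : IndepFun X ξ μ) {σ : ℝ} (hσ : 0 < σ) :
    ∀ᵐ y ∂(μ.map (fun ω => X ω + σ • ξ ω)),
      condDistrib X (fun ω => X ω + σ • ξ ω) μ y = gaussCondLaw P σ y := by
  obtain ⟨hint, hG⟩ := map_smul_stdGaussian_eq_tilted (D := D) hσ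
  have hXm := hX.aemeasurable
  have hξm := hξ.aemeasurable
  have hjoint : μ.map (fun ω => (X ω, σ • ξ ω)) =
      P.prod ((volume : Measure (EuclideanSpace ℝ (Fin D))).tilted
        (fun z => -‖z‖ ^ 2 / (2 * σ ^ 2))) := by
    have h := (indepFun_iff_map_prod_eq_prod_map_map hXm
      (hξm.const_smul σ)).1 (hind.comp measurable_id (measurable_const_smul σ))
    have e : μ.map (σ • ξ) = (volume : Measure (EuclideanSpace ℝ (Fin D))).tilted
        (fun z => -‖z‖ ^ 2 / (2 * σ ^ 2)) := by
      rw [← hG, ← hξ.map_eq, AEMeasurable.map_map_of_aemeasurable (by fun_prop) hξm]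
      rfl
    have h' : μ.map (fun ω => (X ω, (σ • ξ) ω)) = (μ.map X).prod (μ.map (σ • ξ)) := h
    rw [e, hX.map_eq] at h'
    exact h'
  have : IsProbabilityMeasure ((volume : Measure (EuclideanSpace ℝ (Fin D))).tilted
    (fun z => -‖z‖ ^ 2 / (2 * σ ^ 2))) := isProbabilityMeasure_tilted hint
  set g : EuclideanSpace ℝ (Fin D) → ℝ := fun z => Real.exp (-‖z‖ ^ 2 / (2 * σ ^ 2)) with hg
  have hgm : Measurable g := by fun_prop
  have hgpos : ∀ z, 0 < g z := fun z => Real.exp_pos _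
  set Z : ℝ := ∫ z, g z with hZdef
  have hF : ∀ F : EuclideanSpace ℝ (Fin D) × EuclideanSpace ℝ (Fin D) → ℝ≥0∞, Measurable F →
      ∫⁻ ω, F (X ω + σ • ξ ω, X ω) ∂μ =
        ∫⁻ y, ∫⁻ x, ENNReal.ofReal (g (y - x) / Z) * F (y, x) ∂P := by
    intro F hFm
    have h1 : ∫⁻ ω, F (X ω + σ • ξ ω, X ω) ∂μ =
        ∫⁻ p, F (p.1 + p.2, p.1) ∂(μ.map (fun ω => (X ω, σ • ξ ω))) := by
      rw [lintegral_map' (by fun_prop) (by fun_prop)]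
    rw [h1, hjoint, lintegral_prod _ (by fun_prop)]
    conv_rhs => rw [lintegral_lintegral_swap (by fun_prop)]
    refine lintegral_congr fun x => ?_
    rw [lintegral_tilted]
    rw [← lintegral_sub_right_eq_self _ x]
    refine lintegral_congr fun y => ?_
    rw [add_sub_cancel]
  suffices h : condDistrib X (fun ω => X ω + σ • ξ ω) μ
      =ᵐ[μ.map (fun ω => X ω + σ • ξ ω)] gaussCondKernel P σ from h
  refine condDistrib_ae_eq_of_measure_eq_compProd _ hXm ?_
  refine Measure.ext_of_lintegral _ fun F hFm => ?_
  have hHm : Measurable fun y => ∫⁻ x, F (y, x) ∂(gaussCondKernel P σ y) :=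
    Measurable.lintegral_kernel_prod_right' hFm
  rw [Measure.lintegral_compProd hFm, lintegral_map' (by fun_prop) (by fun_prop),
    lintegral_map' hHm.aemeasurable (by fun_prop), hF F hFm,
    hF (fun p => ∫⁻ x, F (p.1, x) ∂(gaussCondKernel P σ p.1)) (hHm.comp measurable_fst)]
  refine lintegral_congr fun y => ?_
  have hi : Integrable (fun x => g (y - x)) P := integrable_exp_gaussCondLaw P σ y
  have hpos : 0 < ∫ x, g (y - x) ∂P := integral_exp_pos hi
  have hZ : 0 < Z := integral_exp_pos hint
  change _ = ∫⁻ x, ENNReal.ofReal (g (y - x) / Z) * ∫⁻ x', F (y, x') ∂(gaussCondLaw P σ y) ∂P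
  rw [lintegral_mul_const _ (by fun_prop),
    ← ofReal_integral_eq_lintegral_ofReal (hi.div_const Z)
      (Filter.Eventually.of_forall fun x => (div_pos (hgpos _) hZ).le),
    gaussCondLaw, lintegral_tilted, ← lintegral_const_mul _ (by fun_prop)]
  refine lintegral_congr fun x => ?_
  rw [← mul_assoc, ← ENNReal.ofReal_mul (integral_nonneg fun x => (div_pos (hgpos _) hZ).le),
    integral_div]
  congr 2
  change g (y - x) / Z = (∫ x, g (y - x) ∂P) / Z * (g (y - x) / ∫ x, g (y - x) ∂P)
  field_simp

end

/-!
Write `X = Z + W` with `Z ∼ Pslc` and `W ∼ Pcmpct`. Given `X + σ ξ = y` and `W = w`, the variable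
`Z` has law `gaussCondLaw Pslc σ (y - w)`. In a direction `v`, the second moment of `⟨v, X⟩` about a
constant `c` is therefore an average over `w` of the variance of `⟨v, Z⟩` plus the squared
distance from `c` of `⟨v, w + T (y - w)⟩`, where `T u = E[Z | Z + σ ξ = u]`. It suffices that
* the variance is at most `σ² / (1 + m σ²) ‖v‖²` (`variance_inner_gaussCondLaw_le`), and
* `u ↦ u - T u` is Lipschitz with constant `M σ² / (1 + M σ²)` (`norm_residual_sub_le`), so that on
  a set of diameter `2 R` the conditional means stay within `M σ² / (1 + M σ²) R ‖v‖` of a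
  suitable `c`.

Both facts come from the function `p u = ∫ exp (-‖u - x‖² / (2 σ²)) dPslc(x)`. Write `d = a - b` and
`κ' = κ / (1 + κ σ²)` for `κ = m, M`. The midpoint inequalities of the density with constants `m`
and `M` pass to `p` with constants `m'` and `M'`:
* the upper bound `p a * p b ≤ p ((a + b) / 2)² exp (-m' ‖d‖² / 4)` is the Prékopa–Leindler
  inequality (`prekopa_leindler`), proved from Brunn–Minkowski on the line by induction on the
  dimension;
* the lower bound `p ((a + b) / 2)² exp (-M' ‖d‖² / 4) ≤ p a * p b` is the Cauchy–Schwarz inequality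
  after shifting the two integrands by `k` and `-k`, where `k = d / (2 (1 + M σ²))`.

The function `-σ² log p` has gradient `u - T u`. By the two bounds it is convex and `σ² M'`-smooth,
and Baillon–Haddad (`norm_sub_le_of_remainder_bounds`) gives the Lipschitz constant
`σ² M' = M σ² / (1 + M σ²)`. Up to explicit Gaussian factors, the exponential moments of
`⟨v, Z - u⟩` given `Z + σ ξ = u` are ratios of values of `p`, and for this conditional law
the upper bound gives `E exp (t⟨v, Z⟩) * E exp (-t⟨v, Z⟩) ≤ exp (t² ‖v‖² σ² / (1 + m σ²))`, and
letting `t → 0` bounds the variance (`variance_le_of_mgf_mul_mgf_neg_le`).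
-/

/-! ### The Prékopa–Leindler inequality -/

/-- The Brunn–Minkowski inequality on the line, for the midpoint set. It is stated for a set `C`
containing all midpoints because the Minkowski sum of measurable sets need not be measurable. -/
theorem volume_add_volume_le_two_mul_of_midpoint_mem {A B C : Set ℝ} (hA : MeasurableSet A)
    (hB : MeasurableSet B) (hAne : A.Nonempty) (hBne : B.Nonempty)
    (h : ∀ x ∈ A, ∀ y ∈ B, (x + y) / 2 ∈ C) :
    volume A + volume B ≤ 2 * volume C := by
  have key : ∀ A' ⊆ A, IsCompact A' → A'.Nonempty → ∀ B' ⊆ B, IsCompact B' → B'.Nonempty →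
      volume A' + volume B' ≤ 2 * volume C := by
    intro A' hA'A hA' hA'ne B' hB'B hB' hB'ne
    obtain ⟨a, haA, ha⟩ := hA'.exists_isGreatest hA'ne
    obtain ⟨b, hbB, hb⟩ := hB'.exists_isLeast hB'ne
    -- The two half-scale translates `(A' + b) / 2` and `(a + B') / 2` meet at `(a + b) / 2` only.
    have hm1 : MeasurableSet ((fun x : ℝ => 2 * x - b) ⁻¹' A') :=
      hA'.measurableSet.preimage (by fun_prop)
    have hm2 : MeasurableSet ((fun x : ℝ => 2 * x - a) ⁻¹' B') :=
      hB'.measurableSet.preimage (by fun_prop)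
    have hv : ∀ (c : ℝ) (S : Set ℝ),
        2 * volume ((fun x : ℝ => 2 * x - c) ⁻¹' S) = volume S := by
      intro c S
      have e : (fun x : ℝ => 2 * x - c) ⁻¹' S = (2 * ·) ⁻¹' ((· + (-c)) ⁻¹' S) := rfl
      rw [e, Real.volume_preimage_mul_left two_ne_zero, measure_preimage_add_right, ← mul_assoc]
      rw [abs_of_pos (by norm_num), ENNReal.ofReal_inv_of_pos two_pos, ENNReal.ofReal_ofNat,
        ENNReal.mul_inv_cancel two_ne_zero ENNReal.ofNat_ne_top, one_mul]
    have hd : AEDisjoint volume ((fun x : ℝ => 2 * x - b) ⁻¹' A')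
        ((fun x : ℝ => 2 * x - a) ⁻¹' B') := by
      refine measure_mono_null (t := {(a + b) / 2}) ?_ (by simp)
      rintro x ⟨hx1, hx2⟩
      have h1 := ha hx1
      have h2 := hb hx2
      rw [Set.mem_singleton_iff]
      linarith
    rw [← hv b A', ← hv a B', ← mul_add, ← measure_union₀ hm2.nullMeasurableSet hd]
    gcongr
    rintro x (hx | hx)
    · have := h _ (hA'A hx) b (hB'B hbB)
      simpa using this
    · have := h a (hA'A haA) _ (hB'B hx)
      simpa using this
  obtain ⟨a₀, ha₀⟩ := hAne
  obtain ⟨b₀, hb₀⟩ := hBne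
  rw [hA.measure_eq_iSup_isCompact, hB.measure_eq_iSup_isCompact]
  simp only [iSup_and', ← exists_prop]
  simp only [iSup_exists]
  simp only [iSup_and']
  refine ENNReal.biSup_add_biSup_le' ⟨∅, Set.empty_subset _, isCompact_empty⟩
    ⟨∅, Set.empty_subset _, isCompact_empty⟩ fun A' hA' B' hB' => ?_
  -- Adjoining a point makes the compact sets nonempty.
  calc volume A' + volume B' ≤ volume (insert a₀ A') + volume (insert b₀ B') := by
        gcongr <;> exact Set.subset_insert _ _
    _ ≤ 2 * volume C := key _ (Set.insert_subset ha₀ hA'.1) (hA'.2.insert _)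
        (Set.insert_nonempty _ _) _ (Set.insert_subset hb₀ hB'.1) (hB'.2.insert _)
        (Set.insert_nonempty _ _)

/-- The additive form of the Prékopa–Leindler inequality on the line, for functions with
supremum one: it is the midpoint Brunn–Minkowski inequality applied to each superlevel set. -/
theorem lintegral_add_lintegral_le_two_mul_of_iSup_eq_one {f g h : ℝ → ℝ≥0∞} (hf : Measurable f)
    (hg : Measurable g) (hh : Measurable h) (hf1 : ⨆ x, f x = 1) (hg1 : ⨆ x, g x = 1)
    (H : ∀ x y, f x * g y ≤ h ((x + y) / 2) ^ 2) :
    (∫⁻ x, f x) + (∫⁻ x, g x) ≤ 2 * ∫⁻ x, h x := by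
  have layer : ∀ u : ℝ → ℝ≥0∞, Measurable u → (∀ x, u x ≤ 1) →
      ∫⁻ x, u x = ∫⁻ t in Set.Ioi (0 : ℝ), volume {x | ENNReal.ofReal t < u x} := by
    intro u hu hu1
    have hfin : ∀ x, u x ≠ ∞ := fun x => ((hu1 x).trans_lt ENNReal.one_lt_top).ne
    have h1 := lintegral_eq_lintegral_meas_lt volume (f := fun x => (u x).toReal)
      (Filter.Eventually.of_forall fun x => ENNReal.toReal_nonneg) hu.ennreal_toReal.aemeasurable
    simp only [ENNReal.ofReal_toReal (hfin _)] at h1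
    rw [h1]
    refine setLIntegral_congr_fun measurableSet_Ioi fun t ht => ?_
    congr 1
    ext x
    exact (ENNReal.ofReal_lt_iff_lt_toReal (le_of_lt ht) (hfin x)).symm
  have hfle : ∀ x, f x ≤ 1 := fun x => hf1 ▸ le_iSup f x
  have hgle : ∀ x, g x ≤ 1 := fun x => hg1 ▸ le_iSup g x
  have hh' : ∫⁻ x, min (h x) 1 ≤ ∫⁻ x, h x := lintegral_mono fun x => min_le_left _ _
  refine le_trans ?_ (mul_le_mul_right hh' 2)
  rw [layer f hf hfle, layer g hg hgle, layer _ (hh.min measurable_const) fun x => min_le_right _ _,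
    ← lintegral_const_mul' _ _ ENNReal.ofNat_ne_top]
  refine (le_lintegral_add _ _).trans (setLIntegral_mono' measurableSet_Ioi fun t ht => ?_)
  rcases lt_or_ge t 1 with ht1 | ht1
  · have ht1' : ENNReal.ofReal t < 1 := by simpa using ht1
    have hfne : ∃ x, ENNReal.ofReal t < f x := lt_iSup_iff.1 (hf1.symm ▸ ht1')
    have hgne : ∃ x, ENNReal.ofReal t < g x := lt_iSup_iff.1 (hg1.symm ▸ ht1')
    refine volume_add_volume_le_two_mul_of_midpoint_mem (measurableSet_lt measurable_const hf)
      (measurableSet_lt measurable_const hg) hfne hgne fun x hx y hy => lt_min ?_ ht1'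
    refine lt_of_not_ge fun hle => (ENNReal.mul_lt_mul hx hy).not_ge ?_
    rw [← sq]
    exact (H x y).trans (pow_le_pow_left' hle 2)
  · have h0 : ∀ u : ℝ → ℝ≥0∞, (∀ x, u x ≤ 1) → volume {x | ENNReal.ofReal t < u x} = 0 := by
      intro u hu
      have : {x | ENNReal.ofReal t < u x} = ∅ := by
        ext x
        simpa using (hu x).trans (by simpa using ht1)
      rw [this, measure_empty]
    simp only [h0 f hfle, h0 g hgle, add_zero, zero_le]

theorem prekopa_leindler_real {f g h : ℝ → ℝ≥0∞} (hf : Measurable f) (hg : Measurable g)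
    (hh : Measurable h) (H : ∀ x y, f x * g y ≤ h ((x + y) / 2) ^ 2) :
    (∫⁻ x, f x) * (∫⁻ x, g x) ≤ (∫⁻ x, h x) ^ 2 := by
  -- Bounded functions are rescaled to have supremum one.
  have bdd : ∀ f g : ℝ → ℝ≥0∞, Measurable f → Measurable g → ⨆ x, f x ≠ ∞ → ⨆ x, g x ≠ ∞ →
      (∀ x y, f x * g y ≤ h ((x + y) / 2) ^ 2) →
      (∫⁻ x, f x) * (∫⁻ x, g x) ≤ (∫⁻ x, h x) ^ 2 := by
    intro f g hf hg hfb hgb H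
    set a := ⨆ x, f x with ha
    set b := ⨆ x, g x with hb
    rcases eq_or_ne a 0 with ha0 | ha0
    · have : ∀ x, f x = 0 := fun x => le_antisymm (ha0 ▸ le_iSup f x) zero_le
      simp [this]
    rcases eq_or_ne b 0 with hb0 | hb0
    · have : ∀ x, g x = 0 := fun x => le_antisymm (hb0 ▸ le_iSup g x) zero_le
      simp [this]
    obtain ⟨c, hc⟩ : ∃ c : ℝ≥0∞, c ^ 2 = a⁻¹ * b⁻¹ :=
      ⟨(a⁻¹ * b⁻¹) ^ (1 / 2 : ℝ), by rw [← ENNReal.rpow_natCast, ← ENNReal.rpow_mul]; simp⟩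
    have h1 := lintegral_add_lintegral_le_two_mul_of_iSup_eq_one
      (f := fun x => a⁻¹ * f x) (g := fun x => b⁻¹ * g x) (h := fun x => c * h x)
      (hf.const_mul _) (hg.const_mul _) (hh.const_mul _)
      (by rw [← ENNReal.mul_iSup, ← ha, ENNReal.inv_mul_cancel ha0 hfb])
      (by rw [← ENNReal.mul_iSup, ← hb, ENNReal.inv_mul_cancel hb0 hgb]) fun x y => by
        rw [mul_pow, hc, mul_mul_mul_comm]
        gcongr
        exact H x y
    rw [lintegral_const_mul _ hf, lintegral_const_mul _ hg, lintegral_const_mul _ hh] at h1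
    have h2 : 4 * ((a⁻¹ * ∫⁻ x, f x) * (b⁻¹ * ∫⁻ x, g x)) ≤ 4 * (c * ∫⁻ x, h x) ^ 2 := by
      calc 4 * ((a⁻¹ * ∫⁻ x, f x) * (b⁻¹ * ∫⁻ x, g x))
          ≤ (a⁻¹ * (∫⁻ x, f x) + b⁻¹ * ∫⁻ x, g x) ^ 2 := by
            generalize a⁻¹ * ∫⁻ x, f x = s
            generalize b⁻¹ * ∫⁻ x, g x = t
            rcases eq_or_ne s ∞ with rfl | hs
            · simp
            rcases eq_or_ne t ∞ with rfl | ht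
            · simp
            lift s to ℝ≥0 using hs
            lift t to ℝ≥0 using ht
            have := four_mul_le_sq_add (s : ℝ) t
            rw [mul_assoc] at this
            exact_mod_cast this
        _ ≤ (2 * (c * ∫⁻ x, h x)) ^ 2 := by gcongr
        _ = 4 * (c * ∫⁻ x, h x) ^ 2 := by rw [mul_pow]; norm_num
    rw [ENNReal.mul_le_mul_iff_right (by norm_num) (by norm_num), mul_pow, hc,
      mul_mul_mul_comm, ENNReal.mul_le_mul_iff_right] at h2
    · exact h2
    · exact mul_ne_zero (ENNReal.inv_ne_zero.2 hfb) (ENNReal.inv_ne_zero.2 hgb)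
    · exact ENNReal.mul_ne_top (ENNReal.inv_ne_top.2 ha0) (ENNReal.inv_ne_top.2 hb0)
  have trunc : ∀ u : ℝ → ℝ≥0∞, Measurable u →
      ∫⁻ x, u x = ⨆ n : ℕ, ∫⁻ x, min (u x) n := by
    intro u hu
    rw [← lintegral_iSup (fun n => hu.min measurable_const)]
    · refine lintegral_congr fun x => ?_
      rw [← inf_iSup_eq, ENNReal.iSup_natCast, inf_top_eq]
    · intro n k hnk x
      exact min_le_min_left _ (by exact_mod_cast hnk)
  have hb : ∀ (u : ℝ → ℝ≥0∞) (n : ℕ), ⨆ x, min (u x) n ≠ ∞ := fun u n =>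
    ((iSup_le fun x => min_le_right _ _).trans_lt (ENNReal.natCast_lt_top n)).ne
  rw [trunc f hf, trunc g hg, ENNReal.iSup_mul]
  refine iSup_le fun n => ?_
  rw [ENNReal.mul_iSup]
  refine iSup_le fun k => bdd _ _ (hf.min measurable_const) (hg.min measurable_const)
    (hb f n) (hb g k) fun x y => le_trans ?_ (H x y)
  gcongr <;> exact min_le_left _ _

/-- The Prékopa–Leindler inequality tensorises: integrate out one coordinate at a time. -/
theorem prekopa_leindler_pi {n : ℕ} {f g h : (Fin n → ℝ) → ℝ≥0∞} (hf : Measurable f)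
    (hg : Measurable g) (hh : Measurable h)
    (H : ∀ x y, f x * g y ≤ h ((1 / 2 : ℝ) • (x + y)) ^ 2) :
    (∫⁻ x, f x) * (∫⁻ x, g x) ≤ (∫⁻ x, h x) ^ 2 := by
  induction n with
  | zero =>
    have e : ∀ f : (Fin 0 → ℝ) → ℝ≥0∞, ∫⁻ x, f x = f 0 := by
      intro f
      rw [lintegral_unique, volume_pi, Measure.pi_of_empty _ default, measure_univ, mul_one]
      exact congrArg f (Subsingleton.elim _ _)
    simp only [e]
    simpa using H 0 0
  | succ n ih =>
    have e : ∀ f : (Fin (n + 1) → ℝ) → ℝ≥0∞, Measurable f →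
        ∫⁻ x, f x = ∫⁻ s : ℝ, ∫⁻ x : Fin n → ℝ, f (Fin.cons s x) := by
      intro f hf
      have hp := (volume_preserving_piFinSuccAbove (fun _ : Fin (n + 1) => ℝ) 0).symm
      rw [← hp.lintegral_comp hf, Measure.volume_eq_prod]
      refine (lintegral_prod _ (hf.comp hp.measurable).aemeasurable).trans ?_
      simp only [MeasurableEquiv.piFinSuccAbove, Function.comp_apply, MeasurableEquiv.symm_mk,
        MeasurableEquiv.coe_mk, Equiv.symm_symm, Fin.insertNthEquiv_zero]
      rfl
    have hc : Measurable fun p : ℝ × (Fin n → ℝ) => (Fin.cons p.1 p.2 : Fin (n + 1) → ℝ) := by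
      refine measurable_pi_iff.2 fun i => ?_
      refine Fin.cases ?_ (fun j => ?_) i
      · simpa using measurable_fst
      · simp only [Fin.cons_succ]
        fun_prop
    rw [e f hf, e g hg, e h hh]
    refine prekopa_leindler_real (hf.comp hc).lintegral_prod_right'
      (hg.comp hc).lintegral_prod_right' (hh.comp hc).lintegral_prod_right' fun s t => ?_
    refine ih (by fun_prop) (by fun_prop) (by fun_prop) fun x y => ?_
    convert H (Fin.cons s x) (Fin.cons t y) using 3
    funext i
    refine Fin.cases ?_ (fun j => ?_) i
    · simp; ring
    · simp [mul_add]

/-- The Prékopa–Leindler inequality at the midpoint, in Euclidean space. -/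
theorem prekopa_leindler {D : ℕ} {f g h : EuclideanSpace ℝ (Fin D) → ℝ≥0∞} (hf : Measurable f)
    (hg : Measurable g) (hh : Measurable h)
    (H : ∀ x y, f x * g y ≤ h ((1 / 2 : ℝ) • (x + y)) ^ 2) :
    (∫⁻ x, f x) * (∫⁻ x, g x) ≤ (∫⁻ x, h x) ^ 2 := by
  have hp := PiLp.volume_preserving_toLp (Fin D)
  rw [← hp.lintegral_comp hf, ← hp.lintegral_comp hg, ← hp.lintegral_comp hh]
  exact prekopa_leindler_pi (hf.comp hp.measurable) (hg.comp hp.measurable)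
    (hh.comp hp.measurable) fun x y => H _ _

/-! ### The Cauchy–Schwarz inequality -/

/-- The Cauchy–Schwarz inequality, in a form dual to `prekopa_leindler`. -/
theorem sq_lintegral_le_of_sq_le_mul {α : Type*} [MeasurableSpace α] {μ : Measure α}
    {f g h : α → ℝ≥0∞} (hf : AEMeasurable f μ) (hg : AEMeasurable g μ)
    (H : ∀ x, h x ^ 2 ≤ f x * g x) :
    (∫⁻ x, h x ∂μ) ^ 2 ≤ (∫⁻ x, f x ∂μ) * ∫⁻ x, g x ∂μ := by
  have sqrt_sq : ∀ a : ℝ≥0∞, (a ^ (1 / 2 : ℝ)) ^ 2 = a := fun a => by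
    rw [← ENNReal.rpow_natCast, ← ENNReal.rpow_mul]; simp
  have h1 : ∫⁻ x, h x ∂μ ≤ (∫⁻ x, f x ∂μ) ^ (1 / 2 : ℝ) * (∫⁻ x, g x ∂μ) ^ (1 / 2 : ℝ) := by
    refine le_trans (lintegral_mono fun x => ?_)
      (ENNReal.lintegral_mul_norm_pow_le hf hg (by norm_num) (by norm_num) (by norm_num))
    refine (ENNReal.pow_le_pow_left_iff two_ne_zero).1 ?_
    rw [mul_pow, sqrt_sq, sqrt_sq]
    exact H x
  calc (∫⁻ x, h x ∂μ) ^ 2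
      ≤ ((∫⁻ x, f x ∂μ) ^ (1 / 2 : ℝ) * (∫⁻ x, g x ∂μ) ^ (1 / 2 : ℝ)) ^ 2 := by gcongr
    _ = _ := by rw [mul_pow, sqrt_sq, sqrt_sq]

/-! ### Midpoint inequalities for the density -/

theorem IsStronglyLogConcave.mul_le_sq_midpoint {D : ℕ} {m : ℝ}
    {π : EuclideanSpace ℝ (Fin D) → ℝ} (h : IsStronglyLogConcave m π) (hpos : ∀ x, 0 < π x)
    (x y : EuclideanSpace ℝ (Fin D)) :
    π x * π y ≤ π ((1 / 2 : ℝ) • (x + y)) ^ 2 * Real.exp (-(m * ‖x - y‖ ^ 2 / 4)) := by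
  have h1 := h.2.2 (hpos x) (hpos y) (by norm_num : (0 : ℝ) ≤ 1 / 2) (by norm_num : (0 : ℝ) ≤ 1 / 2)
    (by norm_num)
  rw [← smul_add] at h1
  simp only [smul_eq_mul] at h1
  rw [← Real.exp_log (hpos x), ← Real.exp_log (hpos y), ← Real.exp_log (hpos (_ • _)),
    ← Real.exp_add, ← Real.exp_nat_mul, ← Real.exp_add, Real.exp_le_exp]
  push_cast
  linarith

/-- A function whose gradient is `M`-Lipschitz is `M`-semiconvex, in midpoint form. -/
theorem midpoint_semiconvex_of_lipschitz_gradient {E : Type*} [NormedAddCommGroup E]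
    [InnerProductSpace ℝ E] [CompleteSpace E] {M : ℝ≥0} {V : E → ℝ} (hV : Differentiable ℝ V)
    (hL : LipschitzWith M (gradient V)) (x y : E) :
    2 * V ((1 / 2 : ℝ) • (x + y)) - M * ‖x - y‖ ^ 2 / 4 ≤ V x + V y := by
  set c := (1 / 2 : ℝ) • (x + y) with hc
  set k := (1 / 2 : ℝ) • (x - y) with hk
  have hline : ∀ (w : E) (t : ℝ),
      HasDerivAt (fun t : ℝ => V (c + t • w)) (inner ℝ (gradient V (c + t • w)) w) t := by
    intro w t
    have h1 : HasDerivAt (fun t : ℝ => c + t • w) w t := by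
      simpa using ((hasDerivAt_id t).smul_const w).const_add c
    have h2 := (hV (c + t • w)).hasGradientAt.hasFDerivAt.comp_hasDerivAt t h1
    exact h2.congr_deriv (by simp)
  have hd : ∀ t : ℝ, HasDerivAt
      (fun t : ℝ => V (c + t • k) + V (c + t • (-k)) + M * ‖k‖ ^ 2 * t ^ 2)
      (inner ℝ (gradient V (c + t • k)) k + inner ℝ (gradient V (c + t • (-k))) (-k)
        + M * ‖k‖ ^ 2 * (2 * t)) t := by
    intro t
    have h3 : HasDerivAt (fun t : ℝ => (M : ℝ) * ‖k‖ ^ 2 * t ^ 2) (M * ‖k‖ ^ 2 * (2 * t)) t := by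
      simpa using (hasDerivAt_pow 2 t).const_mul ((M : ℝ) * ‖k‖ ^ 2)
    exact ((hline k t).add (hline (-k) t)).add h3
  have hmono := monotoneOn_of_deriv_nonneg (convex_Icc (0 : ℝ) 1)
    (fun t _ => (hd t).continuousAt.continuousWithinAt)
    (fun t _ => (hd t).differentiableAt.differentiableWithinAt) (by
      intro t ht
      rw [interior_Icc] at ht
      rw [(hd t).deriv]
      have h4 : |inner ℝ (gradient V (c + t • k) - gradient V (c + t • (-k))) k|
          ≤ M * (2 * t * ‖k‖) * ‖k‖ := by
        refine (abs_real_inner_le_norm _ _).trans ?_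
        gcongr
        refine (hL.norm_sub_le _ _).trans (le_of_eq ?_)
        rw [show c + t • k - (c + t • (-k)) = (2 * t) • k by module, norm_smul,
          Real.norm_of_nonneg (by linarith [ht.1])]
      rw [inner_neg_right, ← sub_eq_add_neg, ← inner_sub_left]
      have := (abs_le.1 h4).1
      linarith)
  have h5 := hmono (Set.left_mem_Icc.2 zero_le_one) (Set.right_mem_Icc.2 zero_le_one) zero_le_one
  have hx : c + (1 : ℝ) • k = x := by rw [hc, hk]; module
  have hy : c + (1 : ℝ) • (-k) = y := by rw [hc, hk]; module
  have hkn : ‖k‖ = 1 / 2 * ‖x - y‖ := by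
    rw [hk, norm_smul, Real.norm_of_nonneg (by norm_num)]
  simp only [zero_smul, add_zero, hx, hy, hkn] at h5
  linarith

theorem HasLipschitzScore.sq_midpoint_le_mul {D : ℕ} {M : ℝ≥0}
    {π : EuclideanSpace ℝ (Fin D) → ℝ} (h : HasLipschitzScore M π)
    (x y : EuclideanSpace ℝ (Fin D)) :
    π ((1 / 2 : ℝ) • (x + y)) ^ 2 * Real.exp (-(M * ‖x - y‖ ^ 2 / 4)) ≤ π x * π y := by
  obtain ⟨hpos, hdiff, hlip⟩ := h
  have h1 := midpoint_semiconvex_of_lipschitz_gradient (V := fun z => Real.log (π z))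
    (fun z => (hdiff z).log (hpos z).ne') hlip x y
  rw [← Real.exp_log (hpos x), ← Real.exp_log (hpos y), ← Real.exp_log (hpos (_ • _)),
    ← Real.exp_add, ← Real.exp_nat_mul, ← Real.exp_add, Real.exp_le_exp]
  push_cast
  linarith

/-! ### Gaussian smoothing -/

/-- The convolution of `P` with the unnormalised Gaussian kernel of variance `σ²`; up to a constant
factor this is the density of `X + σ ξ` for `(X, ξ) ∼ P ⊗ 𝒩(0, I)`. -/
noncomputable def gaussSmoothing {D : ℕ} (P : Measure (EuclideanSpace ℝ (Fin D))) (σ : ℝ)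
    (u : EuclideanSpace ℝ (Fin D)) : ℝ :=
  ∫ x, Real.exp (-‖u - x‖ ^ 2 / (2 * σ ^ 2)) ∂P

section

variable {D : ℕ} {P : Measure (EuclideanSpace ℝ (Fin D))} [IsProbabilityMeasure P] {σ : ℝ}

theorem gaussSmoothing_pos (u : EuclideanSpace ℝ (Fin D)) : 0 < gaussSmoothing P σ u :=
  integral_exp_pos (integrable_exp_gaussCondLaw P σ u)

theorem ofReal_gaussSmoothing_eq_lintegral {π : EuclideanSpace ℝ (Fin D) → ℝ}
    (hP : P = volume.withDensity fun x => ENNReal.ofReal (π x)) (hπ : Measurable π)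
    (hpos : ∀ x, 0 < π x) (u : EuclideanSpace ℝ (Fin D)) :
    ENNReal.ofReal (gaussSmoothing P σ u) =
      ∫⁻ x, ENNReal.ofReal (π x * Real.exp (-‖u - x‖ ^ 2 / (2 * σ ^ 2))) := by
  rw [gaussSmoothing, ofReal_integral_eq_lintegral_ofReal (integrable_exp_gaussCondLaw P σ u)
    (Filter.Eventually.of_forall fun x => (Real.exp_pos _).le), hP,
    lintegral_withDensity_eq_lintegral_mul _ (by fun_prop) (by fun_prop)]
  refine lintegral_congr fun x => ?_
  rw [Pi.mul_apply, ENNReal.ofReal_mul (hpos x).le]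

/-- Gaussian smoothing of an `m`-strongly log-concave density is `m / (1 + m σ²)`-strongly
log-concave: the Prékopa–Leindler inequality, with the Gaussian exponents completed to a
square. -/
theorem gaussSmoothing_mul_le_sq_midpoint {m : ℝ} (hm : 0 < m) (hσ : 0 < σ)
    {π : EuclideanSpace ℝ (Fin D) → ℝ}
    (hP : P = volume.withDensity fun x => ENNReal.ofReal (π x)) (hπ : Measurable π)
    (hpos : ∀ x, 0 < π x) (hslc : IsStronglyLogConcave m π) (a b : EuclideanSpace ℝ (Fin D)) :
    gaussSmoothing P σ a * gaussSmoothing P σ b ≤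
      gaussSmoothing P σ ((1 / 2 : ℝ) • (a + b)) ^ 2 *
        Real.exp (-(m / (1 + m * σ ^ 2) * ‖a - b‖ ^ 2 / 4)) := by
  set c := m / (1 + m * σ ^ 2) with hc
  have hp := fun u => (gaussSmoothing_pos (P := P) (σ := σ) u).le
  have hsq : Real.exp (-(c * ‖a - b‖ ^ 2 / 4)) = Real.exp (-(c * ‖a - b‖ ^ 2 / 8)) ^ 2 := by
    rw [← Real.exp_nat_mul]; congr 1; push_cast; ring
  rw [hsq, ← mul_pow, ← ENNReal.ofReal_le_ofReal_iff (by positivity),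
    ENNReal.ofReal_mul (hp a), ENNReal.ofReal_pow (mul_nonneg (hp _) (Real.exp_pos _).le),
    mul_comm (gaussSmoothing P σ (_ • _)), ENNReal.ofReal_mul (Real.exp_pos _).le]
  simp only [ofReal_gaussSmoothing_eq_lintegral hP hπ hpos]
  rw [← lintegral_const_mul (ENNReal.ofReal (Real.exp (-(c * ‖a - b‖ ^ 2 / 8)))) (by fun_prop)]
  refine prekopa_leindler (by fun_prop) (by fun_prop) (by fun_prop) fun x y => ?_
  rw [← ENNReal.ofReal_mul (by have := hpos x; positivity), ← ENNReal.ofReal_mul (by positivity),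
    ← ENNReal.ofReal_pow (by have := hpos ((1 / 2 : ℝ) • (x + y)); positivity)]
  refine ENNReal.ofReal_le_ofReal ?_
  have h1 := hslc.mul_le_sq_midpoint hpos x y
  have key : -(m * ‖x - y‖ ^ 2 / 4) + (-‖a - x‖ ^ 2 / (2 * σ ^ 2) + -‖b - y‖ ^ 2 / (2 * σ ^ 2)) ≤
      -(c * ‖a - b‖ ^ 2 / 4) +
        2 * (-‖(1 / 2 : ℝ) • (a + b) - (1 / 2 : ℝ) • (x + y)‖ ^ 2 / (2 * σ ^ 2)) := by
    have e1 : ‖a - x‖ ^ 2 + ‖b - y‖ ^ 2 =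
        2 * ‖(1 / 2 : ℝ) • (a + b) - (1 / 2 : ℝ) • (x + y)‖ ^ 2
          + ‖(a - b) - (x - y)‖ ^ 2 / 2 := by
      have h2 := parallelogram_law_with_norm ℝ (a - x) (b - y)
      rw [show (1 / 2 : ℝ) • (a + b) - (1 / 2 : ℝ) • (x + y)
        = (1 / 2 : ℝ) • ((a - x) + (b - y)) by module, norm_smul,
        show (a - b) - (x - y) = (a - x) - (b - y) by abel, Real.norm_of_nonneg (by norm_num)]
      linarith
    have e2 : (1 + m * σ ^ 2) * (m * σ ^ 2 * ‖x - y‖ ^ 2 + ‖(a - b) - (x - y)‖ ^ 2)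
        - m * σ ^ 2 * ‖a - b‖ ^ 2 = ‖(1 + m * σ ^ 2) • (x - y) - (a - b)‖ ^ 2 := by
      generalize x - y = δ
      generalize a - b = d
      rw [norm_sub_sq_real, norm_sub_sq_real, norm_smul, inner_smul_left, real_inner_comm,
        Real.norm_of_nonneg (by positivity)]
      simp only [conj_trivial]
      ring
    have e3 : c * ‖a - b‖ ^ 2 / 4 ≤
        m * ‖x - y‖ ^ 2 / 4 + ‖(a - b) - (x - y)‖ ^ 2 / (4 * σ ^ 2) := by
      have h3 : m * ‖x - y‖ ^ 2 / 4 + ‖(a - b) - (x - y)‖ ^ 2 / (4 * σ ^ 2)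
          - c * ‖a - b‖ ^ 2 / 4
          = ‖(1 + m * σ ^ 2) • (x - y) - (a - b)‖ ^ 2 / (4 * σ ^ 2 * (1 + m * σ ^ 2)) := by
        rw [← e2, hc]
        field_simp
      have : 0 ≤ ‖(1 + m * σ ^ 2) • (x - y) - (a - b)‖ ^ 2 / (4 * σ ^ 2 * (1 + m * σ ^ 2)) := by
        positivity
      linarith
    rw [← add_div, ← neg_add, e1]
    have e4 : -(2 * ‖(1 / 2 : ℝ) • (a + b) - (1 / 2 : ℝ) • (x + y)‖ ^ 2
          + ‖(a - b) - (x - y)‖ ^ 2 / 2) / (2 * σ ^ 2)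
        = 2 * (-‖(1 / 2 : ℝ) • (a + b) - (1 / 2 : ℝ) • (x + y)‖ ^ 2 / (2 * σ ^ 2))
          - ‖(a - b) - (x - y)‖ ^ 2 / (4 * σ ^ 2) := by
      field_simp
      ring
    rw [e4]
    linarith
  calc π x * Real.exp (-‖a - x‖ ^ 2 / (2 * σ ^ 2)) * (π y * Real.exp (-‖b - y‖ ^ 2 / (2 * σ ^ 2)))
      = π x * π y * Real.exp (-‖a - x‖ ^ 2 / (2 * σ ^ 2) + -‖b - y‖ ^ 2 / (2 * σ ^ 2)) := by
        rw [Real.exp_add]; ring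
    _ ≤ π ((1 / 2 : ℝ) • (x + y)) ^ 2 * Real.exp (-(m * ‖x - y‖ ^ 2 / 4)) *
          Real.exp (-‖a - x‖ ^ 2 / (2 * σ ^ 2) + -‖b - y‖ ^ 2 / (2 * σ ^ 2)) := by gcongr
    _ = π ((1 / 2 : ℝ) • (x + y)) ^ 2 * Real.exp (-(m * ‖x - y‖ ^ 2 / 4) +
          (-‖a - x‖ ^ 2 / (2 * σ ^ 2) + -‖b - y‖ ^ 2 / (2 * σ ^ 2))) := by
        rw [Real.exp_add (-(m * ‖x - y‖ ^ 2 / 4))]; ring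
    _ ≤ π ((1 / 2 : ℝ) • (x + y)) ^ 2 * Real.exp (-(c * ‖a - b‖ ^ 2 / 4) +
        2 * (-‖(1 / 2 : ℝ) • (a + b) - (1 / 2 : ℝ) • (x + y)‖ ^ 2 / (2 * σ ^ 2))) := by gcongr
    _ = _ := by
        rw [mul_pow, mul_pow, ← hsq, Real.exp_add, ← Real.exp_nat_mul]
        push_cast
        ring

/-- Gaussian smoothing of a density with `M`-Lipschitz score is `M / (1 + M σ²)`-semi-log-convex:
the Cauchy–Schwarz inequality, after shifting the two integrands in opposite directions by the
amount that balances the loss in the density against the loss in the Gaussian kernel. -/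
theorem sq_midpoint_le_gaussSmoothing_mul {M : ℝ≥0} (hσ : 0 < σ)
    {π : EuclideanSpace ℝ (Fin D) → ℝ}
    (hP : P = volume.withDensity fun x => ENNReal.ofReal (π x))
    (hscore : HasLipschitzScore M π) (a b : EuclideanSpace ℝ (Fin D)) :
    gaussSmoothing P σ ((1 / 2 : ℝ) • (a + b)) ^ 2 *
        Real.exp (-(M / (1 + M * σ ^ 2) * ‖a - b‖ ^ 2 / 4)) ≤
      gaussSmoothing P σ a * gaussSmoothing P σ b := by
  have hpos := hscore.1
  have hπ : Measurable π := hscore.2.1.continuous.measurable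
  have hM : (0 : ℝ) ≤ M := M.2
  set c := (M : ℝ) / (1 + M * σ ^ 2) with hc
  have hp := fun u => (gaussSmoothing_pos (P := P) (σ := σ) u).le
  have hsq : Real.exp (-(c * ‖a - b‖ ^ 2 / 4)) = Real.exp (-(c * ‖a - b‖ ^ 2 / 8)) ^ 2 := by
    rw [← Real.exp_nat_mul]; congr 1; push_cast; ring
  rw [hsq, ← mul_pow, ← ENNReal.ofReal_le_ofReal_iff (mul_nonneg (hp a) (hp b)),
    ENNReal.ofReal_mul (hp a), ENNReal.ofReal_pow (mul_nonneg (hp _) (Real.exp_pos _).le),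
    mul_comm (gaussSmoothing P σ (_ • _)), ENNReal.ofReal_mul (Real.exp_pos _).le]
  simp only [ofReal_gaussSmoothing_eq_lintegral hP hπ hpos]
  rw [← lintegral_const_mul _ (by fun_prop)]
  set k : EuclideanSpace ℝ (Fin D) := (1 / (2 * (1 + M * σ ^ 2)) : ℝ) • (a - b) with hk
  rw [← lintegral_add_right_eq_self
      (fun x => ENNReal.ofReal (π x * Real.exp (-‖a - x‖ ^ 2 / (2 * σ ^ 2)))) k,
    ← lintegral_sub_right_eq_self
      (fun x => ENNReal.ofReal (π x * Real.exp (-‖b - x‖ ^ 2 / (2 * σ ^ 2)))) k]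
  refine sq_lintegral_le_of_sq_le_mul (by fun_prop) (by fun_prop) fun z => ?_
  rw [← ENNReal.ofReal_mul (by positivity),
    ← ENNReal.ofReal_mul (by have := hpos (z + k); positivity),
    ← ENNReal.ofReal_pow (by have := hpos z; positivity)]
  refine ENNReal.ofReal_le_ofReal ?_
  have h1 := hscore.sq_midpoint_le_mul (z + k) (z - k)
  rw [show (1 / 2 : ℝ) • (z + k + (z - k)) = z by module,
    show z + k - (z - k) = (2 : ℝ) • k by module] at h1
  have key : -(c * ‖a - b‖ ^ 2 / 4) + 2 * (-‖(1 / 2 : ℝ) • (a + b) - z‖ ^ 2 / (2 * σ ^ 2)) =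
      -(M * ‖(2 : ℝ) • k‖ ^ 2 / 4) +
        (-‖a - (z + k)‖ ^ 2 / (2 * σ ^ 2) + -‖b - (z - k)‖ ^ 2 / (2 * σ ^ 2)) := by
    have h2 := parallelogram_law_with_norm ℝ (a - (z + k)) (b - (z - k))
    rw [show a - (z + k) + (b - (z - k)) = (2 : ℝ) • ((1 / 2 : ℝ) • (a + b) - z) by module,
      show a - (z + k) - (b - (z - k)) = (a - b) - (2 : ℝ) • k by module,
      show (a - b) - (2 : ℝ) • k = (M * σ ^ 2 / (1 + M * σ ^ 2) : ℝ) • (a - b) by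
        rw [hk, smul_smul, ← one_smul ℝ (a - b), smul_smul, ← sub_smul, one_smul]
        congr 1
        field_simp
        ring, norm_smul, norm_smul, Real.norm_of_nonneg (by positivity),
      Real.norm_of_nonneg (by positivity)] at h2
    have h3 : ‖(2 : ℝ) • k‖ = 1 / (1 + M * σ ^ 2) * ‖a - b‖ := by
      rw [hk, smul_smul, norm_smul, Real.norm_of_nonneg (by positivity)]
      congr 1
      field_simp
    rw [← add_div, ← neg_add, sq ‖a - (z + k)‖, sq ‖b - (z - k)‖, h3,
      show ‖a - (z + k)‖ * ‖a - (z + k)‖ + ‖b - (z - k)‖ * ‖b - (z - k)‖ =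
        2 * ‖(1 / 2 : ℝ) • (a + b) - z‖ ^ 2
          + (M * σ ^ 2 / (1 + M * σ ^ 2) * ‖a - b‖) ^ 2 / 2 by linarith, hc]
    field_simp
    ring
  calc (Real.exp (-(c * ‖a - b‖ ^ 2 / 8)) *
        (π z * Real.exp (-‖(1 / 2 : ℝ) • (a + b) - z‖ ^ 2 / (2 * σ ^ 2)))) ^ 2
      = π z ^ 2 * Real.exp (-(c * ‖a - b‖ ^ 2 / 4) +
          2 * (-‖(1 / 2 : ℝ) • (a + b) - z‖ ^ 2 / (2 * σ ^ 2))) := by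
        rw [mul_pow, mul_pow, ← hsq, Real.exp_add, ← Real.exp_nat_mul]
        push_cast
        ring
    _ = π z ^ 2 * Real.exp (-(M * ‖(2 : ℝ) • k‖ ^ 2 / 4)) *
        (Real.exp (-‖a - (z + k)‖ ^ 2 / (2 * σ ^ 2)) *
          Real.exp (-‖b - (z - k)‖ ^ 2 / (2 * σ ^ 2))) := by
        rw [key, Real.exp_add, Real.exp_add]; ring
    _ ≤ π (z + k) * π (z - k) * (Real.exp (-‖a - (z + k)‖ ^ 2 / (2 * σ ^ 2)) *
          Real.exp (-‖b - (z - k)‖ ^ 2 / (2 * σ ^ 2))) := by gcongr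
    _ = _ := by ring

end

/-! ### Midpoint convexity and smoothness -/

/-- The tangent inequality for a midpoint-convex function, at a point where it has a directional
derivative: halving the step repeatedly at least halves the increment each time. -/
theorem add_le_of_midpoint_convex_of_hasDerivAt {E : Type*} [AddCommGroup E] [Module ℝ E]
    {H : E → ℝ} (hH : ∀ x y, 2 * H ((1 / 2 : ℝ) • (x + y)) ≤ H x + H y) {a d : E} {H' : ℝ}
    (hd : HasDerivAt (fun t : ℝ => H (a + t • d)) H' 0) : H a + H' ≤ H (a + d) := by
  have step : ∀ n : ℕ, (2 : ℝ) ^ n * (H (a + ((1 / 2 : ℝ) ^ n) • d) - H a) ≤ H (a + d) - H a := by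
    intro n
    induction n with
    | zero => simp
    | succ n ih =>
      have h1 := hH a (a + ((1 / 2 : ℝ) ^ n) • d)
      rw [show (1 / 2 : ℝ) • (a + (a + ((1 / 2 : ℝ) ^ n) • d))
        = a + ((1 / 2 : ℝ) ^ (n + 1)) • d by rw [pow_succ]; module] at h1
      refine le_trans ?_ ih
      rw [pow_succ, mul_assoc]
      gcongr
      linarith
  have hlim : Filter.Tendsto (fun n : ℕ => (1 / 2 : ℝ) ^ n) Filter.atTop (nhdsWithin 0 {0}ᶜ) :=
    tendsto_nhdsWithin_iff.2 ⟨tendsto_pow_atTop_nhds_zero_of_lt_one (by norm_num) (by norm_num),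
      Filter.Eventually.of_forall fun n => by simp⟩
  have h2 := (hasDerivAt_iff_tendsto_slope_zero.1 hd).comp hlim
  have h3 := le_of_tendsto h2 (b := H (a + d) - H a) (Filter.Eventually.of_forall fun n => by
    have := step n
    simpa [← inv_pow] using this)
  linarith

/-- The gradient of a convex function that is `L`-smooth is `L`-Lipschitz (Baillon–Haddad), with
convexity and smoothness expressed by quadratic bounds on the first-order remainder. -/
theorem norm_sub_le_of_remainder_bounds {E : Type*} [NormedAddCommGroup E]
    [InnerProductSpace ℝ E] {G : E → ℝ} {g : E → E} {L : ℝ} (hL : 0 ≤ L)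
    (hlow : ∀ a b, G a + inner ℝ (g a) (b - a) ≤ G b)
    (hup : ∀ a b, G b ≤ G a + inner ℝ (g a) (b - a) + L / 2 * ‖b - a‖ ^ 2) (a b : E) :
    ‖g b - g a‖ ≤ L * ‖b - a‖ := by
  -- Compare the bounds based at `a` and at `b` after a gradient step of length `s` from `b`.
  have step : ∀ (s : ℝ) (a b : E), (s - L / 2 * s ^ 2) * ‖g b - g a‖ ^ 2 ≤
      G b - G a - inner ℝ (g a) (b - a) := by
    intro s a b
    have h1 := hlow a (b - s • (g b - g a))
    have h2 := hup b (b - s • (g b - g a))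
    have h3 : inner ℝ (g b) (g b - g a) - inner ℝ (g a) (g b - g a) = ‖g b - g a‖ ^ 2 := by
      rw [← inner_sub_left, real_inner_self_eq_norm_sq]
    rw [show b - s • (g b - g a) - a = (b - a) - s • (g b - g a) by abel, inner_sub_right,
      inner_smul_right] at h1
    rw [show b - s • (g b - g a) - b = -(s • (g b - g a)) by abel, inner_neg_right,
      inner_smul_right, norm_neg, norm_smul, mul_pow, Real.norm_eq_abs, sq_abs] at h2
    have h4 : s * (inner ℝ (g b) (g b - g a) - inner ℝ (g a) (g b - g a)) =
      s * ‖g b - g a‖ ^ 2 := by rw [h3]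
    linarith
  have hsum : ∀ s : ℝ, (2 * s - L * s ^ 2) * ‖g b - g a‖ ^ 2 ≤ ‖g b - g a‖ * ‖b - a‖ := by
    intro s
    have h1 := step s a b
    have h2 := step s b a
    rw [norm_sub_rev (g a) (g b), ← neg_sub b a, inner_neg_right] at h2
    have h3 := real_inner_le_norm (g b - g a) (b - a)
    rw [inner_sub_left] at h3
    linarith
  by_contra! hlt
  have hpos : 0 < ‖g b - g a‖ := lt_of_le_of_lt (by positivity) hlt
  rcases hL.eq_or_lt with rfl | hL
  · have h1 := hsum ((‖g b - g a‖ * ‖b - a‖ + 1) / ‖g b - g a‖ ^ 2)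
    have h2 : (2 * ((‖g b - g a‖ * ‖b - a‖ + 1) / ‖g b - g a‖ ^ 2)
        - 0 * ((‖g b - g a‖ * ‖b - a‖ + 1) / ‖g b - g a‖ ^ 2) ^ 2) * ‖g b - g a‖ ^ 2
        = 2 * (‖g b - g a‖ * ‖b - a‖ + 1) := by field_simp; ring
    rw [h2] at h1
    have : 0 ≤ ‖g b - g a‖ * ‖b - a‖ := by positivity
    linarith
  · have h1 := hsum (1 / L)
    have h2 : (2 * (1 / L) - L * (1 / L) ^ 2) * ‖g b - g a‖ ^ 2 =
        ‖g b - g a‖ * (‖g b - g a‖ / L) := by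
      field_simp; ring
    rw [h2] at h1
    have h3 := le_of_mul_le_mul_left h1 hpos
    rw [div_le_iff₀ hL] at h3
    linarith

/-! ### Variance from exponential moments -/

theorem two_add_sq_le_exp_add_exp_neg (s : ℝ) : 2 + s ^ 2 ≤ Real.exp s + Real.exp (-s) := by
  have h1 : (s / 2) ^ 2 ≤ Real.sinh (s / 2) ^ 2 := by
    rcases le_total 0 (s / 2) with h | h
    · exact pow_le_pow_left₀ h (Real.self_le_sinh_iff.2 h) 2
    · have := Real.sinh_le_self_iff.2 h
      nlinarith
  have h2 := Real.cosh_two_mul (s / 2)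
  rw [Real.cosh_sq, mul_div_cancel₀ _ two_ne_zero, Real.cosh_eq] at h2
  linarith

/-- A bound on the symmetrised moment generating function bounds the variance; expand both sides
to second order in `t`. -/
theorem variance_le_of_mgf_mul_mgf_neg_le {Ω : Type*} [MeasurableSpace Ω] {ν : Measure Ω}
    [IsProbabilityMeasure ν] {X : Ω → ℝ} (hX : MemLp X 2 ν)
    (hint : ∀ t : ℝ, Integrable (fun ω => Real.exp (t * X ω)) ν) {κ : ℝ} (hκ : 0 ≤ κ)
    (h : ∀ t : ℝ, mgf X ν t * mgf X ν (-t) ≤ Real.exp (κ * t ^ 2)) :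
    Var[X; ν] ≤ κ := by
  have hX1 : Integrable X ν := hX.integrable (by norm_num)
  have key : ∀ t : ℝ, 1 + t ^ 2 * Var[X; ν] ≤ Real.exp (κ * t ^ 2) := by
    intro t
    refine le_trans ?_ (h t)
    set c := ν[X] with hc
    have hY : Integrable (fun ω => X ω - c) ν := hX1.sub (integrable_const c)
    have hY0 : ∫ ω, (X ω - c) ∂ν = 0 := by
      rw [integral_sub hX1 (integrable_const c)]; simp [hc]
    have hY2 : Integrable (fun ω => (X ω - c) ^ 2) ν :=
      (hX.sub (memLp_const c)).integrable_sq
    have hexp : ∀ t : ℝ, Integrable (fun ω => Real.exp (t * (X ω - c))) ν := by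
      intro t
      refine ((hint t).const_mul (Real.exp (-(t * c)))).congr
        (Filter.Eventually.of_forall fun ω => ?_)
      simp only
      rw [← Real.exp_add]; congr 1; ring
    have hmgf : ∀ t : ℝ, mgf X ν t = Real.exp (t * c) * ∫ ω, Real.exp (t * (X ω - c)) ∂ν := by
      intro t
      rw [mgf, ← integral_const_mul]
      refine integral_congr_ae (Filter.Eventually.of_forall fun ω => ?_)
      simp only
      rw [← Real.exp_add]; congr 1; ring
    have hone : ∀ t : ℝ, 1 ≤ ∫ ω, Real.exp (t * (X ω - c)) ∂ν := by
      intro t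
      have h1 : ∫ ω, (t * (X ω - c) + 1) ∂ν = 1 := by
        rw [integral_add (hY.const_mul t) (integrable_const 1), integral_const_mul, hY0]; simp
      rw [← h1]
      exact integral_mono ((hY.const_mul t).add (integrable_const 1)) (hexp t)
        fun ω => Real.add_one_le_exp _
    have htwo : 2 + t ^ 2 * Var[X; ν] ≤
        (∫ ω, Real.exp (t * (X ω - c)) ∂ν) + ∫ ω, Real.exp (-t * (X ω - c)) ∂ν := by
      have h1 : ∫ ω, (2 + t ^ 2 * (X ω - c) ^ 2) ∂ν = 2 + t ^ 2 * Var[X; ν] := by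
        rw [integral_add (integrable_const _) (hY2.const_mul _), integral_const_mul,
          variance_eq_integral hX.aemeasurable, ← hc]
        simp
      rw [← h1, ← integral_add (hexp t) (hexp (-t))]
      refine integral_mono ((integrable_const _).add (hY2.const_mul _))
        ((hexp t).add (hexp (-t))) fun ω => ?_
      have := two_add_sq_le_exp_add_exp_neg (t * (X ω - c))
      rw [mul_pow, ← neg_mul] at this
      exact this
    rw [hmgf, hmgf, mul_mul_mul_comm, ← Real.exp_add,
      show t * c + -t * c = 0 by ring, Real.exp_zero, one_mul]
    nlinarith [hone t, hone (-t)]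
  refine le_of_forall_pos_le_add fun ε hε => ?_
  -- A value of `t ^ 2` for which the quadratic error of the exponential is at most `ε t ^ 2`.
  set r := min (1 / (κ + 1)) (ε / (κ ^ 2 + 1)) with hr
  have hr0 : 0 < r := by positivity
  have hr1 : κ * r ≤ 1 := by
    have h1 : r ≤ 1 / (κ + 1) := min_le_left _ _
    rw [le_div_iff₀ (by positivity)] at h1
    nlinarith
  have hr2 : κ ^ 2 * r ≤ ε := by
    have h1 : r ≤ ε / (κ ^ 2 + 1) := min_le_right _ _
    rw [le_div_iff₀ (by positivity)] at h1
    nlinarith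
  have h1 := key (Real.sqrt r)
  rw [Real.sq_sqrt hr0.le] at h1
  have h2 := (abs_le.1 (Real.abs_exp_sub_one_sub_id_le (x := κ * r)
    (by rw [abs_of_nonneg (by positivity)]; exact hr1))).2
  have h3 : r * Var[X; ν] ≤ r * (κ + ε) := by nlinarith
  exact le_of_mul_le_mul_left h3 hr0

/-! ### Centre of a bounded range -/

theorem exists_center_of_abs_sub_le {α : Type*} {K : Set α} {r : α → ℝ} {R : ℝ}
    (h : ∀ w ∈ K, ∀ w' ∈ K, |r w - r w'| ≤ 2 * R) : ∃ c, ∀ w ∈ K, |r w - c| ≤ R := by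
  rcases K.eq_empty_or_nonempty with rfl | ⟨w₀, hw₀⟩
  · exact ⟨0, by simp⟩
  have hbdd : BddAbove (r '' K) := by
    refine ⟨r w₀ + 2 * R, ?_⟩
    rintro _ ⟨w, hw, rfl⟩
    linarith [(abs_le.1 (h w hw w₀ hw₀)).2]
  refine ⟨sSup (r '' K) - R, fun w hw => abs_le.2 ⟨?_, ?_⟩⟩
  · have : sSup (r '' K) ≤ r w + 2 * R := by
      refine csSup_le ⟨_, Set.mem_image_of_mem r hw₀⟩ ?_
      rintro _ ⟨w', hw', rfl⟩
      linarith [(abs_le.1 (h w' hw' w hw)).2]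
    linarith
  · linarith [le_csSup hbdd (Set.mem_image_of_mem r hw)]

/-! ### Moments of the conditional law -/

section

variable {D : ℕ} {P : Measure (EuclideanSpace ℝ (Fin D))} [IsProbabilityMeasure P] {σ : ℝ}

theorem integral_exp_mul_eq_gaussSmoothing_mul (u : EuclideanSpace ℝ (Fin D))
    (g : EuclideanSpace ℝ (Fin D) → ℝ) :
    ∫ x, Real.exp (-‖u - x‖ ^ 2 / (2 * σ ^ 2)) * g x ∂P =
      gaussSmoothing P σ u * ∫ x, g x ∂(gaussCondLaw P σ u) := by
  have hp : gaussSmoothing P σ u ≠ 0 := (gaussSmoothing_pos u).ne'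
  rw [gaussCondLaw, integral_tilted, ← integral_const_mul]
  refine integral_congr_ae (Filter.Eventually.of_forall fun x => ?_)
  change _ = gaussSmoothing P σ u * (_ / gaussSmoothing P σ u * g x)
  field_simp

theorem memLp_two_gaussCondLaw (hσ : 0 < σ) (u : EuclideanSpace ℝ (Fin D)) :
    MemLp (fun x : EuclideanSpace ℝ (Fin D) => x) 2 (gaussCondLaw P σ u) := by
  rw [memLp_two_iff_integrable_sq_norm (Measurable.aestronglyMeasurable (by fun_prop)),
    gaussCondLaw,
    integrable_tilted_iff (integrable_exp_gaussCondLaw P σ u)]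
  refine Integrable.of_bound (C := 2 * ‖u‖ ^ 2 + 4 * σ ^ 2)
    (Measurable.aestronglyMeasurable (by fun_prop)) (Filter.Eventually.of_forall fun x => ?_)
  rw [smul_eq_mul, Real.norm_of_nonneg (by positivity)]
  set s := ‖u - x‖ ^ 2 / (2 * σ ^ 2) with hs
  have hs0 : 0 ≤ s := by positivity
  have hs' : ‖u - x‖ ^ 2 = 2 * σ ^ 2 * s := by rw [hs]; field_simp
  have h1 : ‖x‖ ^ 2 ≤ 2 * ‖u‖ ^ 2 + 4 * σ ^ 2 * s := by
    have h2 : ‖x‖ ≤ ‖u‖ + ‖u - x‖ := by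
      have := norm_sub_le u (u - x)
      rwa [sub_sub_cancel] at this
    have h3 : ‖x‖ ^ 2 ≤ (‖u‖ + ‖u - x‖) ^ 2 := by gcongr
    nlinarith [sq_nonneg (‖u‖ - ‖u - x‖)]
  have h4 : Real.exp (-s) ≤ 1 := Real.exp_le_one_iff.2 (by linarith)
  have h5 : Real.exp (-s) * s ≤ 1 := by
    have h6 : s ≤ Real.exp s := by linarith [Real.add_one_le_exp s]
    calc Real.exp (-s) * s ≤ Real.exp (-s) * Real.exp s := by gcongr
      _ = 1 := by rw [← Real.exp_add]; simp
  rw [neg_div, ← hs]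
  calc Real.exp (-s) * ‖x‖ ^ 2 ≤ Real.exp (-s) * (2 * ‖u‖ ^ 2 + 4 * σ ^ 2 * s) := by gcongr
    _ = Real.exp (-s) * (2 * ‖u‖ ^ 2) + 4 * σ ^ 2 * (Real.exp (-s) * s) := by ring
    _ ≤ 1 * (2 * ‖u‖ ^ 2) + 4 * σ ^ 2 * 1 := by gcongr
    _ = _ := by ring

theorem memLp_two_inner_gaussCondLaw (hσ : 0 < σ) (u v : EuclideanSpace ℝ (Fin D)) :
    MemLp (fun x : EuclideanSpace ℝ (Fin D) => inner ℝ v x) 2 (gaussCondLaw P σ u) :=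
  (memLp_two_gaussCondLaw hσ u).const_inner v

theorem integrable_gaussCondLaw (hσ : 0 < σ) (u : EuclideanSpace ℝ (Fin D)) :
    Integrable (fun x : EuclideanSpace ℝ (Fin D) => x) (gaussCondLaw P σ u) :=
  (memLp_two_gaussCondLaw hσ u).integrable (by norm_num)

theorem hasDerivAt_gaussSmoothing (hσ : 0 < σ) (a d : EuclideanSpace ℝ (Fin D)) :
    HasDerivAt (fun t : ℝ => gaussSmoothing P σ (a + t • d))
      (gaussSmoothing P σ a * (inner ℝ ((∫ x, x ∂(gaussCondLaw P σ a)) - a) d / σ ^ 2)) 0 := by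
  have h1 := hasDerivAt_integral_of_dominated_loc_of_deriv_le (μ := P) (x₀ := (0 : ℝ))
    (s := Set.univ) (bound := fun _ => ‖d‖ / σ)
    (F := fun t x => Real.exp (-‖a + t • d - x‖ ^ 2 / (2 * σ ^ 2)))
    (F' := fun t x => Real.exp (-‖a + t • d - x‖ ^ 2 / (2 * σ ^ 2)) *
      (inner ℝ (x - (a + t • d)) d / σ ^ 2))
    Filter.univ_mem (Filter.Eventually.of_forall fun t =>
      (integrable_exp_gaussCondLaw P σ _).aestronglyMeasurable)
    (integrable_exp_gaussCondLaw P σ _) (Measurable.aestronglyMeasurable (by fun_prop))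
    (Filter.Eventually.of_forall fun x t _ => ?_) (integrable_const _)
    (Filter.Eventually.of_forall fun x t _ => ?_)
  · refine h1.2.congr_deriv ?_
    simp only [zero_smul, add_zero]
    rw [integral_exp_mul_eq_gaussSmoothing_mul]
    have h2 : ∫ x, inner ℝ (x - a) d ∂(gaussCondLaw P σ a) =
        inner ℝ ((∫ x, x ∂(gaussCondLaw P σ a)) - a) d := by
      have h3 := integrable_gaussCondLaw (P := P) hσ a
      simp_rw [real_inner_comm d]
      rw [integral_inner (𝕜 := ℝ) (f := fun x => x - a) (h3.sub (integrable_const a)),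
        integral_sub h3 (integrable_const a)]
      simp
    rw [integral_div, h2]
  · set w := a + t • d - x with hw
    -- `r exp (-r² / (2σ²)) ≤ σ` for every `r`.
    have h2 : Real.exp (-‖w‖ ^ 2 / (2 * σ ^ 2)) * ‖w‖ ≤ σ := by
      have h3 : ‖w‖ ≤ σ * Real.exp (‖w‖ ^ 2 / (2 * σ ^ 2)) := by
        refine le_trans ?_ (mul_le_mul_of_nonneg_left (Real.add_one_le_exp _) hσ.le)
        have h4 : σ * (‖w‖ ^ 2 / (2 * σ ^ 2) + 1) - ‖w‖ =
            ((‖w‖ - σ) ^ 2 + σ ^ 2) / (2 * σ) := by field_simp; ring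
        have : 0 ≤ ((‖w‖ - σ) ^ 2 + σ ^ 2) / (2 * σ) := by positivity
        linarith
      calc Real.exp (-‖w‖ ^ 2 / (2 * σ ^ 2)) * ‖w‖
          ≤ Real.exp (-‖w‖ ^ 2 / (2 * σ ^ 2)) * (σ * Real.exp (‖w‖ ^ 2 / (2 * σ ^ 2))) := by gcongr
        _ = σ := by rw [mul_left_comm, ← Real.exp_add, neg_div]; simp
    have h5 : |inner ℝ (x - (a + t • d)) d| ≤ ‖w‖ * ‖d‖ := by
      rw [hw, norm_sub_rev]; exact abs_real_inner_le_norm _ _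
    rw [norm_mul, norm_div, Real.norm_of_nonneg (Real.exp_pos _).le, Real.norm_eq_abs,
      Real.norm_of_nonneg (sq_nonneg σ)]
    calc Real.exp (-‖w‖ ^ 2 / (2 * σ ^ 2)) * (|inner ℝ (x - (a + t • d)) d| / σ ^ 2)
        ≤ Real.exp (-‖w‖ ^ 2 / (2 * σ ^ 2)) * (‖w‖ * ‖d‖ / σ ^ 2) := by gcongr
      _ = Real.exp (-‖w‖ ^ 2 / (2 * σ ^ 2)) * ‖w‖ * (‖d‖ / σ ^ 2) := by ring
      _ ≤ σ * (‖d‖ / σ ^ 2) := by gcongr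
      _ = ‖d‖ / σ := by field_simp
  · have h2 : HasDerivAt (fun t : ℝ => a + t • d - x) d t := by
      simpa using (((hasDerivAt_id t).smul_const d).const_add a).sub_const x
    refine ((h2.norm_sq.neg.div_const (2 * σ ^ 2)).exp).congr_deriv ?_
    rw [← neg_sub (a + t • d) x, inner_neg_left, Pi.neg_apply]
    field_simp

/-! ### The conditional mean and variance of the log-concave component -/

variable {π : EuclideanSpace ℝ (Fin D) → ℝ} {m : ℝ} {M : ℝ≥0}

/-- The residual `u - E[X | X + σ ξ = u]` is the gradient of `-σ² log p`, with `p` the Gaussian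
smoothing. That function is convex and `M σ² / (1 + M σ²)`-smooth, whence the Lipschitz
constant. -/
theorem norm_residual_sub_le (hm : 0 < m) (hσ : 0 < σ)
    (hP : P = volume.withDensity fun x => ENNReal.ofReal (π x))
    (hslc : IsStronglyLogConcave m π) (hscore : HasLipschitzScore M π)
    (a b : EuclideanSpace ℝ (Fin D)) :
    ‖(b - ∫ x, x ∂(gaussCondLaw P σ b)) - (a - ∫ x, x ∂(gaussCondLaw P σ a))‖ ≤
      M * σ ^ 2 / (1 + M * σ ^ 2) * ‖b - a‖ := by
  have hM : (0 : ℝ) ≤ M := M.2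
  have hpos := hscore.1
  have hπ : Measurable π := hscore.2.1.continuous.measurable
  have hp := fun u => gaussSmoothing_pos (P := P) (σ := σ) u
  -- Multiplicative midpoint inequalities, in terms of logarithms.
  have hexpmul : ∀ (x y z c : ℝ), 0 < x → 0 < y → 0 < z →
      (x * y ≤ z ^ 2 * Real.exp c ↔ Real.log x + Real.log y ≤ 2 * Real.log z + c) := by
    intro x y z c hx hy hz
    rw [← Real.log_le_log_iff (by positivity) (by positivity), Real.log_mul hx.ne' hy.ne',
      Real.log_mul (by positivity) (by positivity), Real.log_pow, Real.log_exp]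
    norm_num
  have hexpmul' : ∀ (x y z c : ℝ), 0 < x → 0 < y → 0 < z →
      (z ^ 2 * Real.exp c ≤ x * y ↔ 2 * Real.log z + c ≤ Real.log x + Real.log y) := by
    intro x y z c hx hy hz
    rw [← Real.log_le_log_iff (by positivity) (by positivity), Real.log_mul hx.ne' hy.ne',
      Real.log_mul (by positivity) (by positivity), Real.log_pow, Real.log_exp]
    norm_num
  set G : EuclideanSpace ℝ (Fin D) → ℝ := fun u => -(σ ^ 2 * Real.log (gaussSmoothing P σ u))
    with hG
  have hGd : ∀ a d : EuclideanSpace ℝ (Fin D), HasDerivAt (fun t : ℝ => G (a + t • d))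
      (inner ℝ (a - ∫ x, x ∂(gaussCondLaw P σ a)) d) 0 := by
    intro a d
    have h1 := (((hasDerivAt_gaussSmoothing (P := P) hσ a d).log (hp _).ne').const_mul
      (σ ^ 2)).neg
    refine h1.congr_deriv ?_
    have := (hp a).ne'
    rw [← neg_sub a, inner_neg_left, zero_smul, add_zero]
    field_simp
  have hGconv : ∀ x y, 2 * G ((1 / 2 : ℝ) • (x + y)) ≤ G x + G y := by
    intro x y
    have h1 := (hexpmul _ _ _ _ (hp x) (hp y) (hp _)).1
      (gaussSmoothing_mul_le_sq_midpoint hm hσ hP hπ hpos hslc x y)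
    have h2 : 0 ≤ m / (1 + m * σ ^ 2) * ‖x - y‖ ^ 2 / 4 := by positivity
    have h3 : Real.log (gaussSmoothing P σ x) + Real.log (gaussSmoothing P σ y) ≤
      2 * Real.log (gaussSmoothing P σ ((1 / 2 : ℝ) • (x + y))) := by linarith
    have h4 := mul_le_mul_of_nonneg_left h3 (sq_nonneg σ)
    simp only [hG]
    linarith
  set L := (M : ℝ) * σ ^ 2 / (1 + M * σ ^ 2) with hL
  have hL0 : 0 ≤ L := by positivity
  have hGsmooth : ∀ x y, 2 * (L / 2 * ‖(1 / 2 : ℝ) • (x + y)‖ ^ 2 - G ((1 / 2 : ℝ) • (x + y))) ≤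
      (L / 2 * ‖x‖ ^ 2 - G x) + (L / 2 * ‖y‖ ^ 2 - G y) := by
    intro x y
    have h1 := (hexpmul' _ _ _ _ (hp x) (hp y) (hp _)).1
      (sq_midpoint_le_gaussSmoothing_mul hσ hP hscore x y)
    have h4 := mul_le_mul_of_nonneg_left h1 (sq_nonneg σ)
    have h5 := parallelogram_law_with_norm ℝ x y
    have h6 : σ ^ 2 * (M / (1 + M * σ ^ 2) * ‖x - y‖ ^ 2 / 4) = L * (‖x - y‖ ^ 2 / 4) := by
      rw [hL]; ring
    have h7 : L * (‖x + y‖ ^ 2 + ‖x - y‖ ^ 2) = L * (2 * (‖x‖ ^ 2 + ‖y‖ ^ 2)) := by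
      rw [h5]
    rw [norm_smul, Real.norm_of_nonneg (by norm_num)]
    simp only [hG]
    linarith
  refine norm_sub_le_of_remainder_bounds (G := G)
    (g := fun u => u - ∫ x, x ∂(gaussCondLaw P σ u)) hL0 (fun a b => ?_) (fun a b => ?_) a b
  · have h1 := add_le_of_midpoint_convex_of_hasDerivAt hGconv (hGd a (b - a))
    simpa using h1
  · have h2 : HasDerivAt (fun t : ℝ => L / 2 * ‖a + t • (b - a)‖ ^ 2)
        (L * inner ℝ a (b - a)) 0 := by
      have h3 : HasDerivAt (fun t : ℝ => a + t • (b - a)) (b - a) 0 := by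
        simpa using ((hasDerivAt_id (0 : ℝ)).smul_const (b - a)).const_add a
      refine (h3.norm_sq.const_mul (L / 2)).congr_deriv ?_
      rw [zero_smul, add_zero]
      ring
    have h1 := add_le_of_midpoint_convex_of_hasDerivAt
      (H := fun u => L / 2 * ‖u‖ ^ 2 - G u) hGsmooth (h2.sub (hGd a (b - a)))
    rw [add_sub_cancel] at h1
    have h4 : ‖b - a‖ ^ 2 = ‖b‖ ^ 2 - ‖a‖ ^ 2 - 2 * inner ℝ a (b - a) := by
      rw [norm_sub_sq_real, inner_sub_right, real_inner_self_eq_norm_sq, real_inner_comm]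
      ring
    rw [h4]
    linarith

/-- An exponential moment of the conditional law is, up to an explicit factor, a ratio of values of the Gaussian smoothing. -/
theorem mgf_inner_gaussCondLaw (hσ : 0 < σ) (u v : EuclideanSpace ℝ (Fin D)) (t : ℝ) :
    Integrable (fun x => Real.exp (t * inner ℝ v (x - u))) (gaussCondLaw P σ u) ∧
    mgf (fun x => inner ℝ v (x - u)) (gaussCondLaw P σ u) t =
      Real.exp (σ ^ 2 * ‖v‖ ^ 2 * t ^ 2 / 2) *
        (gaussSmoothing P σ (u + (σ ^ 2 * t) • v) / gaussSmoothing P σ u) := by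
  have hp := gaussSmoothing_pos (P := P) (σ := σ) u
  have e : ∀ x, Real.exp (-‖u - x‖ ^ 2 / (2 * σ ^ 2)) * Real.exp (t * inner ℝ v (x - u)) =
      Real.exp (σ ^ 2 * ‖v‖ ^ 2 * t ^ 2 / 2) *
        Real.exp (-‖u + (σ ^ 2 * t) • v - x‖ ^ 2 / (2 * σ ^ 2)) := by
    intro x
    rw [← Real.exp_add, ← Real.exp_add,
      show u + (σ ^ 2 * t) • v - x = (σ ^ 2 * t) • v - (x - u) by abel,
      norm_sub_rev u x, norm_sub_sq_real (_ • v), norm_smul, inner_smul_left,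
      mul_pow, Real.norm_eq_abs, sq_abs]
    congr 1
    simp only [conj_trivial]
    field_simp
    ring
  constructor
  · rw [gaussCondLaw, integrable_tilted_iff (integrable_exp_gaussCondLaw P σ u)]
    simp only [smul_eq_mul, e]
    exact (integrable_exp_gaussCondLaw P σ _).const_mul _
  · have h1 := integral_exp_mul_eq_gaussSmoothing_mul (P := P) (σ := σ) u
      (fun x => Real.exp (t * inner ℝ v (x - u)))
    simp only [e] at h1
    rw [integral_const_mul] at h1
    rw [mgf, ← mul_div_assoc, eq_div_iff hp.ne', mul_comm, ← h1]
    rfl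

/-- The variance bound for the strongly log-concave component alone (Brascamp–Lieb for linear
functions): the symmetrised moment generating function is a ratio of values of the smoothing at
`u ± h` and at `u`, to which strong log-concavity of the smoothing applies. -/
theorem variance_inner_gaussCondLaw_le (hm : 0 < m) (hσ : 0 < σ)
    (hP : P = volume.withDensity fun x => ENNReal.ofReal (π x)) (hπ : Measurable π)
    (hpos : ∀ x, 0 < π x) (hslc : IsStronglyLogConcave m π) (u v : EuclideanSpace ℝ (Fin D)) :
    Var[fun x => inner ℝ v x; gaussCondLaw P σ u] ≤ σ ^ 2 / (1 + m * σ ^ 2) * ‖v‖ ^ 2 := by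
  have hX := memLp_two_inner_gaussCondLaw (P := P) hσ u v
  have hp := fun u => gaussSmoothing_pos (P := P) (σ := σ) u
  rw [← variance_sub_const hX.aestronglyMeasurable (inner ℝ v u)]
  simp only [← inner_sub_right]
  refine variance_le_of_mgf_mul_mgf_neg_le ?_
    (fun t => (mgf_inner_gaussCondLaw hσ u v t).1) (by positivity) fun t => ?_
  · simp only [inner_sub_right]
    exact hX.sub (memLp_const _)
  rw [(mgf_inner_gaussCondLaw hσ u v t).2, (mgf_inner_gaussCondLaw hσ u v (-t)).2]
  have h1 := gaussSmoothing_mul_le_sq_midpoint hm hσ hP hπ hpos hslc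
    (u + (σ ^ 2 * t) • v) (u + (σ ^ 2 * -t) • v)
  rw [show (1 / 2 : ℝ) • (u + (σ ^ 2 * t) • v + (u + (σ ^ 2 * -t) • v)) = u by module,
    show u + (σ ^ 2 * t) • v - (u + (σ ^ 2 * -t) • v) = (2 * σ ^ 2 * t) • v by module,
    norm_smul, mul_pow, Real.norm_eq_abs, sq_abs] at h1
  have h2 : gaussSmoothing P σ (u + (σ ^ 2 * t) • v) / gaussSmoothing P σ u *
      (gaussSmoothing P σ (u + (σ ^ 2 * -t) • v) / gaussSmoothing P σ u) ≤
      Real.exp (-(m / (1 + m * σ ^ 2) * ((2 * σ ^ 2 * t) ^ 2 * ‖v‖ ^ 2) / 4)) := by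
    rw [div_mul_div_comm, div_le_iff₀ (mul_pos (hp u) (hp u))]
    linarith
  calc _ = Real.exp (σ ^ 2 * ‖v‖ ^ 2 * t ^ 2) *
        (gaussSmoothing P σ (u + (σ ^ 2 * t) • v) / gaussSmoothing P σ u *
        (gaussSmoothing P σ (u + (σ ^ 2 * -t) • v) / gaussSmoothing P σ u)) := by
        rw [mul_mul_mul_comm, ← Real.exp_add]
        congr 2
        ring
    _ ≤ Real.exp (σ ^ 2 * ‖v‖ ^ 2 * t ^ 2) *
        Real.exp (-(m / (1 + m * σ ^ 2) * ((2 * σ ^ 2 * t) ^ 2 * ‖v‖ ^ 2) / 4)) := by gcongr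
    _ = _ := by
        rw [← Real.exp_add]
        congr 1
        field_simp
        ring

end

/-! ### The convolution -/

/-- The variance bound in a fixed direction. Given the value of the compact component, the second
moment about `c` splits into the variance of the log-concave component and the squared distance of
the conditional mean from `c`; `c` is the centre of the interval in which these means lie. -/
theorem variance_inner_gaussCondLaw_conv_le {D : ℕ}
    {P Q : Measure (EuclideanSpace ℝ (Fin D))} [IsProbabilityMeasure P] [IsProbabilityMeasure Q]
    {m : ℝ} (hm : 0 < m) {M : ℝ≥0} {π : EuclideanSpace ℝ (Fin D) → ℝ}
    (hP : P = volume.withDensity (fun x => ENNReal.ofReal (π x)))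
    (hslc : IsStronglyLogConcave m π) (hscore : HasLipschitzScore M π)
    {R : ℝ} {K : Set (EuclideanSpace ℝ (Fin D))}
    (hKb : Bornology.IsBounded K) (hKd : Metric.diam K = 2 * R)
    (hK : ∀ᵐ w ∂Q, w ∈ K) {σ : ℝ} (hσ : 0 < σ) (y v : EuclideanSpace ℝ (Fin D)) :
    Var[fun x => inner ℝ v x; gaussCondLaw (P ∗ Q) σ y] ≤
      (σ ^ 2 / (1 + m * σ ^ 2) + R ^ 2 * (M : ℝ) ^ 2 * σ ^ 4 / (1 + (M : ℝ) * σ ^ 2) ^ 2)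
        * ‖v‖ ^ 2 := by
  have hM : (0 : ℝ) ≤ M := M.2
  have hπ : Measurable π := hscore.2.1.continuous.measurable
  set L := (M : ℝ) * σ ^ 2 / (1 + M * σ ^ 2) with hL
  have hL0 : 0 ≤ L := by positivity
  set φ := σ ^ 2 / (1 + m * σ ^ 2) + R ^ 2 * (M : ℝ) ^ 2 * σ ^ 4 / (1 + (M : ℝ) * σ ^ 2) ^ 2
    with hφ
  have hφL : φ * ‖v‖ ^ 2 = σ ^ 2 / (1 + m * σ ^ 2) * ‖v‖ ^ 2 + (‖v‖ * L * R) ^ 2 := by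
    rw [hφ, hL]; field_simp
  -- `r w` is the conditional mean of `⟨v, Z + w⟩` when the compact component equals `w`.
  set r : EuclideanSpace ℝ (Fin D) → ℝ := fun w =>
    inner ℝ v w + ∫ z, inner ℝ v z ∂(gaussCondLaw P σ (y - w)) with hr
  obtain ⟨c, hc⟩ : ∃ c, ∀ w ∈ K, |r w - c| ≤ ‖v‖ * L * R := by
    refine exists_center_of_abs_sub_le fun w hw w' hw' => ?_
    have h1 : r w - r w' = inner ℝ v
        (((y - w') - ∫ z, z ∂(gaussCondLaw P σ (y - w'))) -
          ((y - w) - ∫ z, z ∂(gaussCondLaw P σ (y - w)))) := by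
      simp only [hr]
      rw [integral_inner (integrable_gaussCondLaw hσ _),
        integral_inner (integrable_gaussCondLaw hσ _)]
      simp only [inner_sub_right]
      ring
    have h2 : ‖w - w'‖ ≤ 2 * R := by
      rw [← dist_eq_norm, ← hKd]
      exact Metric.dist_le_diam_of_mem hKb hw hw'
    rw [h1]
    calc _ ≤ ‖v‖ * (L * ‖(y - w') - (y - w)‖) :=
          (abs_real_inner_le_norm _ _).trans (mul_le_mul_of_nonneg_left
            (norm_residual_sub_le hm hσ hP hslc hscore _ _) (norm_nonneg v))
      _ ≤ ‖v‖ * (L * (2 * R)) := by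
          rw [sub_sub_sub_cancel_left]
          gcongr
      _ = 2 * (‖v‖ * L * R) := by ring
  have hX := memLp_two_inner_gaussCondLaw (P := P ∗ Q) hσ y v
  have hXc : MemLp (fun x => inner ℝ v x - c) 2 (gaussCondLaw (P ∗ Q) σ y) :=
    hX.sub (memLp_const c)
  have hint : Integrable (fun x => (inner ℝ v x - c) ^ 2 - φ * ‖v‖ ^ 2)
      (gaussCondLaw (P ∗ Q) σ y) := hXc.integrable_sq.sub (integrable_const _)
  -- Integrate over the strongly log-concave component first, at a fixed value of the other one.
  have hinner : ∀ w ∈ K, ∫ z, Real.exp (-‖y - (z + w)‖ ^ 2 / (2 * σ ^ 2)) *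
      ((inner ℝ v (z + w) - c) ^ 2 - φ * ‖v‖ ^ 2) ∂P ≤ 0 := by
    intro w hw
    have e : ∀ z, y - (z + w) = (y - w) - z := fun z => by abel
    simp only [e]
    rw [integral_exp_mul_eq_gaussSmoothing_mul (P := P) (y - w)
      (fun z => (inner ℝ v (z + w) - c) ^ 2 - φ * ‖v‖ ^ 2)]
    refine mul_nonpos_of_nonneg_of_nonpos (gaussSmoothing_pos _).le ?_
    have hZ := memLp_two_inner_gaussCondLaw (P := P) hσ (y - w) v
    have hZc : MemLp (fun z => inner ℝ v z - (c - inner ℝ v w)) 2 (gaussCondLaw P σ (y - w)) :=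
      hZ.sub (memLp_const _)
    have h1 := variance_eq_sub hZc
    rw [variance_sub_const hZ.aestronglyMeasurable,
      integral_sub (hZ.integrable (by norm_num)) (integrable_const _)] at h1
    have h2 := variance_inner_gaussCondLaw_le hm hσ hP hπ hscore.1 hslc (y - w) v
    have h3 : (r w - c) ^ 2 ≤ (‖v‖ * L * R) ^ 2 :=
      sq_le_sq' (abs_le.1 (hc w hw)).1 (abs_le.1 (hc w hw)).2
    have h4 : ∀ z, inner ℝ v (z + w) - c = inner ℝ v z - (c - inner ℝ v w) := fun z => by
      rw [inner_add_right]; ring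
    simp only [h4]
    rw [integral_sub hZc.integrable_sq (integrable_const _), hφL]
    simp only [Pi.pow_apply, integral_const, probReal_univ, one_smul] at h1 ⊢
    have h5 : r w - c = (∫ z, inner ℝ v z ∂(gaussCondLaw P σ (y - w))) - (c - inner ℝ v w) := by
      rw [hr]; ring
    rw [h5] at h3
    linarith
  have hle : ∫ x, ((inner ℝ v x - c) ^ 2 - φ * ‖v‖ ^ 2) ∂(gaussCondLaw (P ∗ Q) σ y) ≤ 0 := by
    have h1 := integral_exp_mul_eq_gaussSmoothing_mul (P := P ∗ Q) (σ := σ) y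
      (fun x => (inner ℝ v x - c) ^ 2 - φ * ‖v‖ ^ 2)
    have hint' : Integrable (fun x => Real.exp (-‖y - x‖ ^ 2 / (2 * σ ^ 2)) *
        ((inner ℝ v x - c) ^ 2 - φ * ‖v‖ ^ 2)) (P ∗ Q) :=
      (integrable_tilted_iff (integrable_exp_gaussCondLaw (P ∗ Q) σ y) _).1 hint
    refine nonpos_of_mul_nonpos_right (a := gaussSmoothing (P ∗ Q) σ y) ?_ (gaussSmoothing_pos y)
    rw [← h1]
    rw [Measure.conv_comm] at hint' ⊢
    rw [integral_conv hint']
    refine integral_nonpos_of_ae ?_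
    filter_upwards [hK] with w hw
    simpa only [add_comm w, Pi.zero_apply] using hinner w hw
  rw [integral_sub hXc.integrable_sq (integrable_const _)] at hle
  simp only [integral_const, probReal_univ, one_smul] at hle
  rw [← variance_sub_const hX.aestronglyMeasurable c]
  refine (variance_le_expectation_sq hXc.aestronglyMeasurable).trans ?_
  simp only [Pi.pow_apply]
  linarith

theorem dotProduct_covMat_mulVec {D : ℕ} {Q : Measure (EuclideanSpace ℝ (Fin D))}
    [IsProbabilityMeasure Q] (hQ : MemLp (fun x : EuclideanSpace ℝ (Fin D) => x) 2 Q)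
    (a : Fin D → ℝ) :
    dotProduct a ((covMat Q).mulVec a) = Var[fun x => inner ℝ (WithLp.toLp 2 a) x; Q] := by
  have hi : ∀ i, MemLp (fun x : EuclideanSpace ℝ (Fin D) => a i * x i) 2 Q := fun i =>
    ((EuclideanSpace.proj i : EuclideanSpace ℝ (Fin D) →L[ℝ] ℝ).comp_memLp' hQ).const_mul (a i)
  have e : (fun x : EuclideanSpace ℝ (Fin D) => inner ℝ (WithLp.toLp 2 a) x) =
      fun x => ∑ i, a i * x i := by
    funext x
    simp [PiLp.inner_apply, mul_comm]
  rw [e, variance_fun_sum hi]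
  simp only [dotProduct, Matrix.mulVec, covMat, Matrix.of_apply, Finset.mul_sum]
  refine Finset.sum_congr rfl fun i _ => Finset.sum_congr rfl fun j _ => ?_
  rw [covariance_const_mul_left, covariance_const_mul_right]
  ring

theorem mainTheorem6 {D : ℕ}
    (Pslc Pcmpct : Measure (EuclideanSpace ℝ (Fin D)))
    [IsProbabilityMeasure Pslc] [IsProbabilityMeasure Pcmpct]
    (m : ℝ) (hm : 0 < m) (M : ℝ≥0)
    (π : EuclideanSpace ℝ (Fin D) → ℝ)
    (hdens : Pslc = volume.withDensity (fun x => ENNReal.ofReal (π x)))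
    (hslc : IsStronglyLogConcave m π)
    (hscore : HasLipschitzScore M π)
    (𝔇 : ℝ) (K : Set (EuclideanSpace ℝ (Fin D)))
    (hKb : Bornology.IsBounded K) (hKd : Metric.diam K = 2 * 𝔇)
    (hK : ∀ᵐ w ∂Pcmpct, w ∈ K) :
    SatisfiesCondVarBound (Pslc ∗ Pcmpct)
      (fun σ => σ ^ 2 / (1 + m * σ ^ 2)
        + 𝔇 ^ 2 * (M : ℝ) ^ 2 * σ ^ 4 / (1 + (M : ℝ) * σ ^ 2) ^ 2) := by
  intro σ hσ
  refine ⟨by positivity, fun y => ?_⟩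
  have hQ := memLp_two_gaussCondLaw (P := Pslc ∗ Pcmpct) hσ y
  refine ⟨hQ, Matrix.PosSemidef.of_dotProduct_mulVec_nonneg ?_ fun a => ?_⟩
  · ext i j
    simp only [Matrix.conjTranspose_apply, Matrix.sub_apply, Matrix.smul_apply, Matrix.one_apply,
      covMat, Matrix.of_apply, star_trivial, eq_comm (a := j)]
    rw [covariance_comm]
  · have h1 := variance_inner_gaussCondLaw_conv_le hm hdens hslc hscore hKb hKd hK hσ y
      (WithLp.toLp 2 a)
    rw [← dotProduct_covMat_mulVec hQ, EuclideanSpace.real_norm_sq_eq] at h1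
    rw [star_trivial, Matrix.sub_mulVec, dotProduct_sub, Matrix.smul_mulVec, Matrix.one_mulVec,
      dotProduct_smul, sub_nonneg, smul_eq_mul]
    refine h1.trans_eq ?_
    simp [dotProduct, sq]
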